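/- Let $b=\frac{(5+\sqrt{57})^2}{4(8+\sqrt{57})}$, so $2.532<b<2.533$. A literal is a Boolean variable or its negation, a clause is a set of literals (read as a disjunction), and a 3-CNF formula is a finite set of clauses with at most three literals each (read as a conjunction). Ball-3-SAT is the problem: given a 3-CNF formula $F$ over $n$ variables, an assignment $\alpha\in\{0,1\}^n$ and $r\in\mathbb N$, decide whether there is an assignment $\alpha^*\in\{0,1\}^n$ that satisfies $F$ and has Hamming distance $d_H(\alpha,\alpha^*)\le r$. Let $\mathrm{Neg}_\alpha(F)$ be the set of the clauses of $F$ all of whose literals are false under $\alpha$; for $\alpha=(1,\dots,1)$ this is the set $\mathrm{Neg}(F)$ of the clauses of $F$ that have only negative literals. Restricted to the instances $(F,\alpha,r)$ for which $\mathrm{Neg}_\alpha(F)$ consists of pairwise disjoint clauses with exactly three literals each, Ball-3-SAT can be solved deterministically in time $O^*(b^r)$. That is, there are one deterministic algorithm and one polynomial $p$ such that on every such instance the algorithm halts with the correct answer after at most $p(n)\,b^r$ steps. (Algorithms are first-order functional programs over binary trees, with unit cost for each evaluation step: variable access, constant, pairing, left and right component, test for the empty tree, local definition, and function call.) -/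

import Mathlib

namespace BallSat

/-! ### Formulas and the ball problem -/

/-- Assignments to the `n` variables `0, …, n - 1`. -/
abbrev Assignment (n : ℕ) := Fin n → Bool

/-- A literal: a variable and a sign. `(x, true)` is the positive literal `x`,
`(x, false)` is its negation. -/
abbrev Literal (n : ℕ) := Fin n × Bool

/-- A clause (a disjunction), as the set of its literals. -/
abbrev Clause (n : ℕ) := Finset (Literal n)

/-- A CNF formula (a conjunction), as the set of its clauses. -/
abbrev CNF (n : ℕ) := Finset (Clause n)

/-- The literal `l` is true under `α`. -/
def Literal.Holds {n : ℕ} (α : Assignment n) (l : Literal n) : Prop := α l.1 = l.2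

/-- `α` satisfies the clause `C`. -/
def Clause.Sat {n : ℕ} (α : Assignment n) (C : Clause n) : Prop := ∃ l ∈ C, Literal.Holds α l

/-- `α` satisfies the formula `F`. -/
def CNF.Sat {n : ℕ} (α : Assignment n) (F : CNF n) : Prop := ∀ C ∈ F, Clause.Sat α C

/-- The clauses of `F` all of whose literals are false under `α`. For `α = (1, …, 1)` these are
the clauses of `F` with only negative literals. -/
def CNF.neg {n : ℕ} (α : Assignment n) (F : CNF n) : Set (Clause n) :=
  {C | C ∈ F ∧ ∀ l ∈ C, ¬ Literal.Holds α l}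

/-- The question asked by the ball problem: does the Hamming ball of radius `r` around `α`
contain an assignment that satisfies `F`? -/
def SatInBall {n : ℕ} (F : CNF n) (α : Assignment n) (r : ℕ) : Prop :=
  ∃ β : Assignment n, CNF.Sat β F ∧ hammingDist α β ≤ r

/-- The list of lists `L` writes down `F`: every clause of `F` once, in any order, and in it
every literal once, in any order. -/
def Lists {n : ℕ} (L : List (List (Literal n))) (F : CNF n) : Prop :=
  (∀ c ∈ L, c.Nodup) ∧ (L.map List.toFinset).Nodup ∧ (L.map List.toFinset).toFinset = F

/-! ### The machine model

Deterministic first-order functional programs over binary trees (pure LISP without symbols), with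
unit cost for each evaluation step. Each step takes constant time on a pointer machine or on a
random access machine. -/

/-- The data: binary trees without labels. -/
inductive Tree where
  | nil : Tree
  | cons : Tree → Tree → Tree

/-- The left subtree; that of `nil` is `nil`. -/
def Tree.hd : Tree → Tree
  | .nil => .nil
  | .cons a _ => a

/-- The right subtree; that of `nil` is `nil`. -/
def Tree.tl : Tree → Tree
  | .nil => .nil
  | .cons _ b => b

/-- Expressions. Variables are de Bruijn indices: `bind e b` is `let x := e in b`, where `x` is
variable `0` of `b`. `call f e` applies the `f`-th function of the program to the value of `e`. -/
inductive Expr where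
  | var : ℕ → Expr
  | nil : Expr
  | cons : Expr → Expr → Expr
  | hd : Expr → Expr
  | tl : Expr → Expr
  | cond : Expr → Expr → Expr → Expr
  | bind : Expr → Expr → Expr
  | call : ℕ → Expr → Expr

/-- A program: a main expression and the bodies of finitely many, mutually recursive functions of
one argument. The argument of a function, and the input of `main`, is variable `0`. -/
structure Program where
  main : Expr
  funs : List Expr

/-- `Eval P env e v t`: in the environment `env` (the values of the variables `0, 1, …`) the
expression `e` evaluates to `v` in exactly `t` steps (call by value). A computation that does not
terminate, or that calls a function which `P` does not have, has no value. -/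
inductive Eval (P : Program) : List Tree → Expr → Tree → ℕ → Prop
  | var (env : List Tree) (i : ℕ) : Eval P env (.var i) (env.getD i .nil) 1
  | nil (env : List Tree) : Eval P env .nil .nil 1
  | cons {env : List Tree} {e₁ e₂ : Expr} {v₁ v₂ : Tree} {t₁ t₂ : ℕ} :
      Eval P env e₁ v₁ t₁ → Eval P env e₂ v₂ t₂ →
      Eval P env (.cons e₁ e₂) (.cons v₁ v₂) (t₁ + t₂ + 1)
  | hd {env : List Tree} {e : Expr} {v : Tree} {t : ℕ} :
      Eval P env e v t → Eval P env (.hd e) v.hd (t + 1)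
  | tl {env : List Tree} {e : Expr} {v : Tree} {t : ℕ} :
      Eval P env e v t → Eval P env (.tl e) v.tl (t + 1)
  | condCons {env : List Tree} {c e₁ e₂ : Expr} {a b v : Tree} {t₁ t₂ : ℕ} :
      Eval P env c (.cons a b) t₁ → Eval P env e₁ v t₂ →
      Eval P env (.cond c e₁ e₂) v (t₁ + t₂ + 1)
  | condNil {env : List Tree} {c e₁ e₂ : Expr} {v : Tree} {t₁ t₂ : ℕ} :
      Eval P env c .nil t₁ → Eval P env e₂ v t₂ →
      Eval P env (.cond c e₁ e₂) v (t₁ + t₂ + 1)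
  | bind {env : List Tree} {e b : Expr} {u v : Tree} {t₁ t₂ : ℕ} :
      Eval P env e u t₁ → Eval P (u :: env) b v t₂ →
      Eval P env (.bind e b) v (t₁ + t₂ + 1)
  | call {env : List Tree} {f : ℕ} {e body : Expr} {u v : Tree} {t₁ t₂ : ℕ} :
      P.funs[f]? = some body → Eval P env e u t₁ → Eval P [u] body v t₂ →
      Eval P env (.call f e) v (t₁ + t₂ + 1)

/-- On the input `x` the program `P` halts with the output `y` after exactly `t` steps. -/
def Program.Outputs (P : Program) (x y : Tree) (t : ℕ) : Prop := Eval P [x] P.main y t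

/-! ### Encoding of the instances -/

/-- `0 ↦ nil`, `1 ↦ cons nil nil`. -/
def Tree.ofBool : Bool → Tree
  | false => .nil
  | true => .cons .nil .nil

/-- Unary numerals. -/
def Tree.ofNat : ℕ → Tree
  | 0 => .nil
  | k + 1 => .cons .nil (Tree.ofNat k)

/-- Lists, with `enc` for the entries. -/
def Tree.ofList {A : Type} (enc : A → Tree) : List A → Tree
  | [] => .nil
  | a :: l => .cons (enc a) (Tree.ofList enc l)

/-- A literal: the pair of the index of its variable and its sign. -/
def Tree.ofLiteral {n : ℕ} (l : Literal n) : Tree :=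
  .cons (Tree.ofNat l.1) (Tree.ofBool l.2)

/-- The instance `(α, F, r)`, where `L` lists the clauses of `F`. -/
def Tree.ofInstance {n : ℕ} (α : Assignment n) (L : List (List (Literal n))) (r : ℕ) : Tree :=
  .cons (Tree.ofList Tree.ofBool (List.ofFn α))
    (.cons (Tree.ofList (Tree.ofList Tree.ofLiteral) L) (Tree.ofNat r))

/-- The number `b`. -/
noncomputable def base : ℝ := (5 + √57) ^ 2 / (4 * (8 + √57))

end BallSat

/-! The algorithm is a local search whose budget counts half flips: an ordinary flip costs 2. Its
running time grows by the factor `rate = 1.59` per unit of budget, and a budget `2 * r + K` with a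
constant `K` suffices. Since `rate ^ 2 = 2.5281 < base`, this gives the bound with some slack.

Each clause that is false under `α` is opened: one of its three variables, the core, is flipped
tentatively, and the other two become its sides. If the core alone has to be flipped in the end,
nothing remains to be paid; `openCost` gives the other costs. From then on a clause that is false at
present must contain a literal that is true under `α` (`Valid.exists_pos`). Making such a literal
true means withdrawing the core of an open clause, hence flipping one of its sides: two branches of
cost 5. A literal that is false under `α` costs one branch of cost 2 if its variable is `out`; a
side gives two branches, of cost 5 (core withdrawn) and 3 (core confirmed), which together weigh
less. A clause with at most three literals, at least one of them true under `α`, therefore has total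
branching weight at most `2 * rate ^ (-2) + 2 * rate ^ (-5) < 1` (`attempt_runs`, `sum_share_le`,
`scan_runs`). If no clause is false, the present assignment satisfies the formula, and it has no
more flips than any solution compatible with the decisions made (`Valid.countP_le`), so comparing
the number of flips with `r` is enough.

It remains to choose the cores. For a nonempty target set `S` of variables to be flipped in a
clause, the average over the three representatives of `rate` to the decrease of the weight exceeds 1
(`sum_rate_pow_gain`). For groups of `K` clauses this advantage is exponential in `K`, whereas the
number of gain levels and the logarithmic loss of greedy covering are polynomial. So for a suitable
`K` there is a fixed table of codewords with prices that serves every target and satisfies a Kraft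
inequality (`exists_code`). Trying the whole table on group after group keeps the running time
within a constant times a polynomial times `rate ^ W` (`expand_runs`). The table is hard-wired into
the program, so its mere existence is enough. -/

namespace BallSat

/-! ### Running times of expressions -/

/-- `e` evaluates to `v` in at most `T` steps. -/
def Runs (P : Program) (env : List Tree) (e : Expr) (v : Tree) (T : ℝ) : Prop :=
  ∃ t : ℕ, (t : ℝ) ≤ T ∧ Eval P env e v t

/-- The expressions built from variables with `nil`, `cons`, `hd` and `tl`. -/
def Expr.isPure : Expr → Bool
  | .var _ => true
  | .nil => true
  | .cons a b => a.isPure && b.isPure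
  | .hd a => a.isPure
  | .tl a => a.isPure
  | _ => false

/-- The value of a pure expression. -/
def Expr.value (env : List Tree) : Expr → Tree
  | .var i => env.getD i .nil
  | .cons a b => .cons (a.value env) (b.value env)
  | .hd a => (a.value env).hd
  | .tl a => (a.value env).tl
  | _ => .nil

/-- The number of steps that a pure expression takes. -/
def Expr.size : Expr → ℕ
  | .cons a b => a.size + b.size + 1
  | .hd a => a.size + 1
  | .tl a => a.size + 1
  | _ => 1

theorem Expr.eval_of_isPure (P : Program) (env : List Tree) :
    ∀ e : Expr, e.isPure = true → Eval P env e (e.value env) e.size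
  | .var i, _ => .var env i
  | .nil, _ => .nil env
  | .cons a b, h => by
      simp only [Expr.isPure, Bool.and_eq_true] at h
      exact .cons (eval_of_isPure P env a h.1) (eval_of_isPure P env b h.2)
  | .hd a, h => .hd (eval_of_isPure P env a h)
  | .tl a, h => .tl (eval_of_isPure P env a h)
  | .cond _ _ _, h => by simp [Expr.isPure] at h
  | .bind _ _, h => by simp [Expr.isPure] at h
  | .call _ _, h => by simp [Expr.isPure] at h

section Rules

variable {P : Program} {env : List Tree} {e e₁ e₂ c body : Expr} {u v v₁ v₂ a b : Tree}
  {S T T₁ T₂ : ℝ} {f : ℕ}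

theorem Runs.mono (h : Runs P env e v S) (hST : S ≤ T) : Runs P env e v T :=
  let ⟨t, ht, he⟩ := h
  ⟨t, ht.trans hST, he⟩

/-- For concrete expressions both hypotheses hold by `rfl`, so the control flow of the program is
all that has to be traced by hand. -/
theorem Runs.pure (h : e.isPure = true) (hv : e.value env = v) : Runs P env e v e.size :=
  ⟨e.size, le_rfl, hv ▸ Expr.eval_of_isPure P env e h⟩

theorem Runs.cons (h₁ : Runs P env e₁ v₁ T₁) (h₂ : Runs P env e₂ v₂ T₂) :
    Runs P env (.cons e₁ e₂) (.cons v₁ v₂) (T₁ + T₂ + 1) := by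
  obtain ⟨t₁, h₁, k₁⟩ := h₁
  obtain ⟨t₂, h₂, k₂⟩ := h₂
  exact ⟨_, by push_cast; linarith, .cons k₁ k₂⟩

theorem Runs.hd (h : Runs P env e v T) : Runs P env (.hd e) v.hd (T + 1) := by
  obtain ⟨t, h, k⟩ := h
  exact ⟨_, by push_cast; linarith, .hd k⟩

theorem Runs.condCons (h₁ : Runs P env c (.cons a b) T₁) (h₂ : Runs P env e₁ v T₂) :
    Runs P env (.cond c e₁ e₂) v (T₁ + T₂ + 1) := by
  obtain ⟨t₁, h₁, k₁⟩ := h₁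
  obtain ⟨t₂, h₂, k₂⟩ := h₂
  exact ⟨_, by push_cast; linarith, .condCons k₁ k₂⟩

theorem Runs.condNil (h₁ : Runs P env c .nil T₁) (h₂ : Runs P env e₂ v T₂) :
    Runs P env (.cond c e₁ e₂) v (T₁ + T₂ + 1) := by
  obtain ⟨t₁, h₁, k₁⟩ := h₁
  obtain ⟨t₂, h₂, k₂⟩ := h₂
  exact ⟨_, by push_cast; linarith, .condNil k₁ k₂⟩

theorem Runs.bind (h₁ : Runs P env e u T₁) (h₂ : Runs P (u :: env) body v T₂) :
    Runs P env (.bind e body) v (T₁ + T₂ + 1) := by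
  obtain ⟨t₁, h₁, k₁⟩ := h₁
  obtain ⟨t₂, h₂, k₂⟩ := h₂
  exact ⟨_, by push_cast; linarith, .bind k₁ k₂⟩

theorem Runs.call (hf : P.funs[f]? = some body) (h₁ : Runs P env e u T₁)
    (h₂ : Runs P [u] body v T₂) : Runs P env (.call f e) v (T₁ + T₂ + 1) := by
  obtain ⟨t₁, h₁, k₁⟩ := h₁
  obtain ⟨t₂, h₂, k₂⟩ := h₂
  exact ⟨_, by push_cast; linarith, .call hf k₁ k₂⟩

/-- The expression `true`. -/
abbrev Expr.tt : Expr := .cons .nil .nil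

/-- Short-circuit disjunction. -/
theorem Runs.or {x y : Bool} (h₁ : Runs P env c (Tree.ofBool x) T₁)
    (h₂ : Runs P env e (Tree.ofBool y) T₂) (hT : 0 ≤ T₂) :
    Runs P env (.cond c .tt e) (Tree.ofBool (x || y)) (T₁ + T₂ + 4) := by
  cases x
  · exact (Runs.condNil h₁ h₂).mono (by linarith)
  · exact (Runs.condCons (v := Tree.ofBool (true || y)) h₁ (Runs.pure rfl rfl)).mono
      (by norm_num [Expr.size]; linarith)

end Rules

/-! ### The states of the search -/

/-- The status of a variable during the search: `out` is open, `yes` and `no` are decided to be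
flipped and not to be flipped; `core y z` is the tentatively flipped representative of an open
falsified clause, whose other variables are `y` and `z`; `side x z` is a variable of an open
falsified clause with the representative `x` and the third variable `z`. -/
inductive Status (n : ℕ) where
  | out : Status n
  | yes : Status n
  | no : Status n
  | core : Fin n → Fin n → Status n
  | side : Fin n → Fin n → Status n

namespace Status

/-- Is the variable flipped at present? -/
def flipped {n : ℕ} : Status n → Bool
  | .yes => true
  | .core _ _ => true
  | _ => false

/-- The encoding of the status. -/
def enc {n : ℕ} : Status n → Tree
  | .out => .nil
  | .no => .cons .nil .nil
  | .side x z => .cons .nil (.cons (Tree.ofNat x) (Tree.ofNat z))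
  | .yes => .cons (.cons .nil .nil) .nil
  | .core y z => .cons (.cons .nil .nil) (.cons (Tree.ofNat y) (Tree.ofNat z))

theorem hd_enc {n : ℕ} (s : Status n) : s.enc.hd = Tree.ofBool s.flipped := by
  cases s <;> rfl

end Status

/-- A state: the status of every variable. -/
abbrev State (n : ℕ) := Fin n → Status n

/-- The present assignment. -/
def State.current {n : ℕ} (α : Assignment n) (σ : State n) : Assignment n :=
  fun i => xor (α i) (σ i).flipped

/-- The encoding of a state. -/
def State.enc {n : ℕ} (σ : State n) : Tree := Tree.ofList Status.enc (List.ofFn σ)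

/-- The encoding of an assignment. -/
abbrev encAssignment {n : ℕ} (α : Assignment n) : Tree := Tree.ofList Tree.ofBool (List.ofFn α)

/-- The encoding of a clause. -/
abbrev encClause {n : ℕ} (c : List (Literal n)) : Tree := Tree.ofList Tree.ofLiteral c

/-- The encoding of a formula. -/
abbrev encFormula {n : ℕ} (L : List (List (Literal n))) : Tree := Tree.ofList encClause L

/-! ### The program -/

/-- `e` with `tl` applied `d` times. -/
def Expr.drop (e : Expr) : ℕ → Expr
  | 0 => e
  | d + 1 => .tl (e.drop d)

/-- `get (i, l)` is entry `i` of `l`. -/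
abbrev fGet : ℕ := 0
/-- `set (i, v, l)` replaces entry `i` of `l` by `v`. -/
abbrev fSet : ℕ := 1
/-- `pos (α, l)`: is the literal `l` true under `α`? -/
abbrev fPos : ℕ := 2
/-- `truth (α, σ, l)`: is the literal `l` true at present? -/
abbrev fTruth : ℕ := 3
/-- `csat (α, σ, c)`: is the clause `c` true at present? -/
abbrev fCsat : ℕ := 4
/-- `within (σ, r)`: are at most `r` variables flipped? -/
abbrev fWithin : ℕ := 5
/-- `scan (L', x, σ, W)`: local search with budget `W`, where `L'` remains to be checked. -/
abbrev fScan : ℕ := 6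
/-- `branch (c, x, σ, W)`: branch on the literals of the false clause `c`. -/
abbrev fBranch : ℕ := 7
/-- `attempt (l, x, σ, W)`: branch on the ways to make the literal `l` true. -/
abbrev fAttempt : ℕ := 8
/-- `child (p, a, q, z, x, σ, W)`: search with `p` set to `a`, `q` to `yes` and `z` to `out`. -/
abbrev fChild : ℕ := 9
/-- `negs (σ, α, L)`: the clauses of `L` that are false in the state `σ`. -/
abbrev fNegs : ℕ := 10
/-- `zeros l` replaces all entries of `l` by `nil`. -/
abbrev fZeros : ℕ := 11
/-- `double r` is `2 * r`, followed by a constant. -/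
abbrev fDouble : ℕ := 12
/-- `open (x, y, z, σ)` makes `x` a core with sides `y` and `z`. -/
abbrev fOpen : ℕ := 13
/-- `expand (bs, x, σ, W)`: choose the representatives of the clauses `bs`, then search. -/
abbrev fExpand : ℕ := 14

/-- The argument of the function. -/
abbrev Expr.arg : Expr := .var 0

/-- Body of `get`. -/
def getBody : Expr :=
  .cond (.hd .arg) (.call fGet (.cons (.tl (.hd .arg)) (.tl (.tl .arg)))) (.hd (.tl .arg))

/-- Body of `set`. -/
def setBody : Expr :=
  .cond (.hd .arg)
    (.cons (.hd (.tl (.tl .arg)))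
      (.call fSet (.cons (.tl (.hd .arg)) (.cons (.hd (.tl .arg)) (.tl (.tl (.tl .arg)))))))
    (.cons (.hd (.tl .arg)) (.tl (.tl (.tl .arg))))

/-- Body of `pos`. -/
def posBody : Expr :=
  .cond (.call fGet (.cons (.hd (.tl .arg)) (.hd .arg)))
    (.tl (.tl .arg))
    (.cond (.tl (.tl .arg)) .nil .tt)

/-- Body of `truth`. -/
def truthBody : Expr :=
  .cond (.call fPos (.cons (.hd .arg) (.tl (.tl .arg))))
    (.cond (.hd (.call fGet (.cons (.hd (.tl (.tl .arg))) (.hd (.tl .arg))))) .nil .tt)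
    (.hd (.call fGet (.cons (.hd (.tl (.tl .arg))) (.hd (.tl .arg)))))

/-- Body of `csat`. -/
def csatBody : Expr :=
  .cond (.tl (.tl .arg))
    (.cond (.call fTruth (.cons (.hd .arg) (.cons (.hd (.tl .arg)) (.hd (.tl (.tl .arg)))))) .tt
      (.call fCsat (.cons (.hd .arg) (.cons (.hd (.tl .arg)) (.tl (.tl (.tl .arg)))))))
    .nil

/-- Body of `within`. -/
def withinBody : Expr :=
  .cond (.hd .arg)
    (.cond (.hd (.hd (.hd .arg)))
      (.cond (.tl .arg) (.call fWithin (.cons (.tl (.hd .arg)) (.tl (.tl .arg)))) .nil)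
      (.call fWithin (.cons (.tl (.hd .arg)) (.tl .arg))))
    .tt

/-- Body of `scan`. -/
def scanBody : Expr :=
  .cond (.hd .arg)
    (.cond
      (.call fCsat (.cons (.hd (.hd (.tl .arg))) (.cons (.hd (.tl (.tl .arg))) (.hd (.hd .arg)))))
      (.call fScan (.cons (.tl (.hd .arg)) (.tl .arg)))
      (.call fBranch (.cons (.hd (.hd .arg)) (.tl .arg))))
    (.call fWithin (.cons (.hd (.tl (.tl .arg))) (.tl (.tl (.hd (.tl .arg))))))

/-- Body of `branch`. -/
def branchBody : Expr :=
  .cond (.hd .arg)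
    (.cond (.call fAttempt (.cons (.hd (.hd .arg)) (.tl .arg))) .tt
      (.call fBranch (.cons (.tl (.hd .arg)) (.tl .arg))))
    .nil

/-- Inside `attempt`, below one local definition: pay `d`, and search the child in which the core
`p` of a clause becomes `a`, its side `q` becomes `yes`, and its side `z` becomes `out`. -/
def childExpr (d : ℕ) (p a q z : Expr) : Expr :=
  .cond (Expr.drop (.cons .nil (.tl (.tl (.tl (.var 1))))) d)
    (.call fChild (.cons p (.cons a (.cons q (.cons z (.cons (.hd (.tl (.var 1)))
      (.cons (.hd (.tl (.tl (.var 1)))) (Expr.drop (.tl (.tl (.tl (.var 1)))) d))))))))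
    .nil

/-- The status `no`. -/
def noExpr : Expr := .cons .nil .nil

/-- The status `yes`. -/
def yesExpr : Expr := .cons (.cons .nil .nil) .nil

/-- Branching on a literal that is true under `α`; variable `0` is its status. -/
def attemptPos : Expr :=
  .cond (.tl (.var 0))
    (.cond (childExpr 5 (.hd (.hd (.var 1))) noExpr (.hd (.tl (.var 0))) (.tl (.tl (.var 0)))) .tt
      (childExpr 5 (.hd (.hd (.var 1))) noExpr (.tl (.tl (.var 0))) (.hd (.tl (.var 0)))))
    .nil

/-- Branching on a literal that is false under `α`; variable `0` is its status. -/
def attemptNeg : Expr :=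
  .cond (.var 0)
    (.cond (.tl (.var 0))
      (.cond (childExpr 5 (.hd (.tl (.var 0))) noExpr (.hd (.hd (.var 1))) (.tl (.tl (.var 0)))) .tt
        (childExpr 3 (.hd (.tl (.var 0))) yesExpr (.hd (.hd (.var 1))) (.tl (.tl (.var 0)))))
      .nil)
    (.cond (Expr.drop (.cons .nil (.tl (.tl (.tl (.var 1))))) 2)
      (.call fScan (.cons (.hd (.tl (.hd (.tl (.var 1))))) (.cons (.hd (.tl (.var 1)))
        (.cons (.call fSet (.cons (.hd (.hd (.var 1))) (.cons yesExpr (.hd (.tl (.tl (.var 1)))))))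
          (Expr.drop (.tl (.tl (.tl (.var 1)))) 2)))))
      .nil)

/-- Body of `attempt`. -/
def attemptBody : Expr :=
  .cond (.call fPos (.cons (.hd (.hd (.tl .arg))) (.hd .arg)))
    (.bind (.call fGet (.cons (.hd (.hd .arg)) (.hd (.tl (.tl .arg))))) attemptPos)
    (.bind (.call fGet (.cons (.hd (.hd .arg)) (.hd (.tl (.tl .arg))))) attemptNeg)

/-- Body of `child`. -/
def childBody : Expr :=
  .call fScan (.cons (.hd (.tl (.hd (Expr.drop .arg 4)))) (.cons (.hd (Expr.drop .arg 4))
    (.cons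
      (.call fSet (.cons (.hd .arg) (.cons (.hd (Expr.drop .arg 1))
        (.call fSet (.cons (.hd (Expr.drop .arg 2)) (.cons yesExpr
          (.call fSet (.cons (.hd (Expr.drop .arg 3)) (.cons .nil
            (.hd (Expr.drop .arg 5)))))))))))
      (Expr.drop .arg 6))))

/-- Body of `negs`. -/
def negsBody : Expr :=
  .cond (.tl (.tl .arg))
    (.cond (.call fCsat (.cons (.hd (.tl .arg)) (.cons (.hd .arg) (.hd (.tl (.tl .arg))))))
      (.call fNegs (.cons (.hd .arg) (.cons (.hd (.tl .arg)) (.tl (.tl (.tl .arg))))))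
      (.cons (.hd (.tl (.tl .arg)))
        (.call fNegs (.cons (.hd .arg) (.cons (.hd (.tl .arg)) (.tl (.tl (.tl .arg))))))))
    .nil

/-- Body of `zeros`. -/
def zerosBody : Expr := .cond .arg (.cons .nil (.call fZeros (.tl .arg))) .nil

/-- The numeral `k`. -/
def numeral : ℕ → Expr
  | 0 => .nil
  | k + 1 => .cons .nil (numeral k)

/-- Body of `double`, where the constant is `K`. -/
def doubleBody (K : ℕ) : Expr :=
  .cond .arg (.cons .nil (.cons .nil (.call fDouble (.tl .arg)))) (numeral K)

/-- Body of `open`. -/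
def openBody : Expr :=
  .cond (.hd .arg)
    (.call fSet (.cons (.hd (.hd .arg)) (.cons
        (.cons (.cons .nil .nil)
          (.cons (.hd (.hd (Expr.drop .arg 1))) (.hd (.hd (Expr.drop .arg 2)))))
      (.call fSet (.cons (.hd (.hd (Expr.drop .arg 1))) (.cons
          (.cons .nil (.cons (.hd (.hd .arg)) (.hd (.hd (Expr.drop .arg 2)))))
        (.call fSet (.cons (.hd (.hd (Expr.drop .arg 2))) (.cons
            (.cons .nil (.cons (.hd (.hd .arg)) (.hd (.hd (Expr.drop .arg 1)))))
          (Expr.drop .arg 3))))))))))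
    (Expr.drop .arg 3)

/-- Inside `expand`: literal `j` of the clause number `i`. -/
def blockLiteral (i j : ℕ) : Expr := .hd (Expr.drop (.hd (Expr.drop (.hd .arg) i)) j)

/-- Inside `expand`: the state after the first `k` clauses are opened with the representatives
given by `c`. -/
def codeExpr (c : ℕ → Fin 3) : ℕ → Expr
  | 0 => .hd (.tl (.tl .arg))
  | i + 1 => .call fOpen (.cons (blockLiteral i (c i)) (.cons (blockLiteral i (c i + 1 : Fin 3))
      (.cons (blockLiteral i (c i + 2 : Fin 3)) (codeExpr c i))))

/-- Inside `expand`: pay `d` and open `K` clauses as `c` says. -/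
def entryExpr (K : ℕ) (c : ℕ → Fin 3) (d : ℕ) : Expr :=
  .cond (Expr.drop (.cons .nil (.tl (.tl (.tl .arg)))) d)
    (.call fExpand (.cons (Expr.drop (.hd .arg) K) (.cons (.hd (.tl .arg))
      (.cons (codeExpr c K) (Expr.drop (.tl (.tl (.tl .arg))) d)))))
    .nil

/-- Inside `expand`: try all entries of the table. -/
def tableExpr (K : ℕ) : List ((ℕ → Fin 3) × ℕ) → Expr
  | [] => .nil
  | x :: l => .cond (entryExpr K x.1 x.2) .tt (tableExpr K l)

/-- Body of `expand`. -/
def expandBody (K : ℕ) (table : List ((ℕ → Fin 3) × ℕ)) : Expr :=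
  .cond (.hd .arg) (tableExpr K table)
    (.call fScan (.cons (.hd (.tl (.hd (.tl .arg)))) (.tl .arg)))

/-- The main expression. -/
def mainExpr : Expr :=
  .bind (.call fZeros (.hd .arg))
    (.call fExpand (.cons
      (.call fNegs (.cons (.var 0) (.cons (.hd (.var 1)) (.hd (.tl (.var 1))))))
      (.cons (.var 1) (.cons (.var 0) (.call fDouble (.tl (.tl (.var 1))))))))

/-- The program. -/
def program (K : ℕ) (table : List ((ℕ → Fin 3) × ℕ)) : Program where
  main := mainExpr
  funs := [getBody, setBody, posBody, truthBody, csatBody, withinBody, scanBody, branchBody,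
    attemptBody, childBody, negsBody, zerosBody, doubleBody K, openBody, expandBody K table]

/-! ### The auxiliary functions -/

section Auxiliary

variable {K : ℕ} {table : List ((ℕ → Fin 3) × ℕ)}

local notation "ℙ" => program K table

theorem get_runs {A : Type} (enc : A → Tree) (xs : List A) (i : ℕ) (hi : i < xs.length) :
    Runs ℙ [.cons (Tree.ofNat i) (Tree.ofList enc xs)] getBody (enc xs[i]) (20 * (i + 1)) := by
  induction i generalizing xs with
  | zero =>
    obtain _ | ⟨x, xs⟩ := xs
    · simp at hi
    refine Runs.mono (Runs.condNil (.pure rfl rfl) (.pure rfl rfl)) ?_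
    norm_num [Expr.size]
  | succ i ih =>
    obtain _ | ⟨x, xs⟩ := xs
    · simp at hi
    refine Runs.mono (Runs.condCons (.pure rfl rfl)
      (Runs.call rfl (.pure rfl rfl) (ih xs (by simpa using hi)))) ?_
    norm_num [Expr.size]; linarith

theorem set_runs {A : Type} (enc : A → Tree) (xs : List A) (i : ℕ) (hi : i < xs.length) (a : A) :
    Runs ℙ [.cons (Tree.ofNat i) (.cons (enc a) (Tree.ofList enc xs))] setBody
      (Tree.ofList enc (xs.set i a)) (40 * (i + 1)) := by
  induction i generalizing xs with
  | zero =>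
    obtain _ | ⟨x, xs⟩ := xs
    · simp at hi
    refine Runs.mono (Runs.condNil (.pure rfl rfl) (.pure rfl rfl)) ?_
    norm_num [Expr.size]
  | succ i ih =>
    obtain _ | ⟨x, xs⟩ := xs
    · simp at hi
    refine Runs.mono (Runs.condCons (.pure rfl rfl)
      (Runs.cons (.pure rfl rfl) (Runs.call rfl (.pure rfl rfl)
        (ih xs (by simpa using hi))))) ?_
    norm_num [Expr.size]; linarith

variable {n : ℕ}

theorem getFin_runs {A : Type} (enc : A → Tree) (f : Fin n → A) (i : Fin n) :
    Runs ℙ [.cons (Tree.ofNat i) (Tree.ofList enc (List.ofFn f))] getBody (enc (f i))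
      (20 * (n + 1)) := by
  have h := get_runs (K := K) (table := table) enc (List.ofFn f) i (by simp)
  simp only [List.getElem_ofFn, Fin.eta] at h
  refine h.mono ?_
  have : (i : ℝ) ≤ n := by exact_mod_cast i.2.le
  linarith

theorem setState_runs (σ : State n) (i : Fin n) (s : Status n) :
    Runs ℙ [.cons (Tree.ofNat i) (.cons s.enc σ.enc)] setBody
      (State.enc (Function.update σ i s)) (40 * (n + 1)) := by
  have h := set_runs (K := K) (table := table) Status.enc (List.ofFn σ) i (by simp) s
  have e : (List.ofFn σ).set i s = List.ofFn (Function.update σ i s) := by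
    apply List.ext_getElem (by simp)
    intro j h₁ h₂
    simp only [List.getElem_set, List.getElem_ofFn, Function.update_apply, Fin.ext_iff, eq_comm]
  rw [e] at h
  refine h.mono ?_
  have : (i : ℝ) ≤ n := by exact_mod_cast i.2.le
  linarith

theorem pos_runs (α : Assignment n) (l : Literal n) :
    Runs ℙ [.cons (encAssignment α) (Tree.ofLiteral l)] posBody
      (Tree.ofBool (decide (α l.1 = l.2))) (40 * (n + 1)) := by
  have hg := getFin_runs (K := K) (table := table) Tree.ofBool α l.1
  have hn : (0 : ℝ) ≤ n := n.cast_nonneg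
  obtain ⟨i, s⟩ := l
  cases hα : α i
  · rw [hα] at hg
    cases s
    · refine Runs.mono (Runs.condNil (Runs.call rfl (.pure rfl rfl) hg)
        (Runs.condNil (.pure rfl rfl) (Runs.pure rfl ?_))) ?_
      · simp [Tree.ofBool, Expr.value]
      · norm_num [Expr.size]; linarith
    · refine Runs.mono (Runs.condNil (Runs.call rfl (.pure rfl rfl) hg)
        (Runs.condCons (.pure rfl rfl) (Runs.pure rfl ?_))) ?_
      · simp [Tree.ofBool, Expr.value]
      · norm_num [Expr.size]; linarith
  · rw [hα] at hg
    refine Runs.mono (Runs.condCons (Runs.call rfl (.pure rfl rfl) hg) (Runs.pure rfl ?_)) ?_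
    · cases s <;> simp [Tree.ofLiteral, Tree.tl, Expr.value]
    · norm_num [Expr.size]; linarith

instance (α : Assignment n) (l : Literal n) : Decidable (Literal.Holds α l) :=
  inferInstanceAs (Decidable (α l.1 = l.2))

theorem truth_runs (α : Assignment n) (σ : State n) (l : Literal n) :
    Runs ℙ [.cons (encAssignment α) (.cons σ.enc (Tree.ofLiteral l))] truthBody
      (Tree.ofBool (decide (Literal.Holds (σ.current α) l))) (100 * (n + 1)) := by
  have hg := getFin_runs (K := K) (table := table) Status.enc σ l.1
  have hp := pos_runs (K := K) (table := table) α l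
  have hn : (0 : ℝ) ≤ n := n.cast_nonneg
  have hf := Runs.hd (Runs.call (P := ℙ) (f := fGet)
    (env := [.cons (encAssignment α) (.cons σ.enc (Tree.ofLiteral l))])
    (e := .cons (.hd (.tl (.tl .arg))) (.hd (.tl .arg))) rfl (.pure rfl rfl) hg)
  rw [Status.hd_enc] at hf
  by_cases h : α l.1 = l.2
  · rw [decide_eq_true h] at hp
    cases hs : (σ l.1).flipped
    · rw [hs] at hf
      refine Runs.mono (Runs.condCons (Runs.call rfl (.pure rfl rfl) hp)
        (Runs.condNil hf (Runs.pure rfl ?_))) ?_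
      · simp [Literal.Holds, State.current, h, hs, Tree.ofBool, Expr.value]
      · norm_num [Expr.size]; linarith
    · rw [hs] at hf
      refine Runs.mono (Runs.condCons (Runs.call rfl (.pure rfl rfl) hp)
        (Runs.condCons hf (Runs.pure rfl ?_))) ?_
      · simp [Literal.Holds, State.current, h, hs, Tree.ofBool, Expr.value]
      · norm_num [Expr.size]; linarith
  · rw [decide_eq_false h] at hp
    have e : decide (Literal.Holds (σ.current α) l) = (σ l.1).flipped := by
      exact (by decide : ∀ a s f : Bool, a ≠ s → decide (xor a f = s) = f) _ _ _ h
    rw [e]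
    refine Runs.mono (Runs.condNil (Runs.call rfl (.pure rfl rfl) hp) hf) ?_
    norm_num [Expr.size]; linarith

/-- Some literal of the list is true. -/
def ListSat (β : Assignment n) (c : List (Literal n)) : Prop := ∃ l ∈ c, Literal.Holds β l

instance (β : Assignment n) (c : List (Literal n)) : Decidable (ListSat β c) :=
  inferInstanceAs (Decidable (∃ l ∈ c, Literal.Holds β l))

theorem csat_runs (α : Assignment n) (σ : State n) (c : List (Literal n)) :
    Runs ℙ [.cons (encAssignment α) (.cons σ.enc (encClause c))] csatBody
      (Tree.ofBool (decide (ListSat (σ.current α) c))) (150 * (n + 1) * (c.length + 1)) := by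
  have hn : (0 : ℝ) ≤ n := n.cast_nonneg
  induction c with
  | nil =>
    refine Runs.mono (Runs.condNil (.pure rfl rfl) (Runs.pure rfl ?_)) ?_
    · simp [ListSat, Tree.ofBool, Expr.value]
    · norm_num [Expr.size]; linarith
  | cons l c ih =>
    have ht := truth_runs (K := K) (table := table) α σ l
    have hor := Runs.or (Runs.call (f := fTruth) (P := ℙ)
      (env := [.cons (encAssignment α) (.cons σ.enc (encClause (l :: c)))])
      (e := .cons (.hd .arg) (.cons (.hd (.tl .arg)) (.hd (.tl (.tl .arg))))) rfl
      (.pure rfl rfl) ht) (Runs.call (f := fCsat)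
      (e := .cons (.hd .arg) (.cons (.hd (.tl .arg)) (.tl (.tl (.tl .arg))))) rfl
      (.pure rfl rfl) ih) (by positivity)
    have e : decide (ListSat (σ.current α) (l :: c)) =
        (decide (Literal.Holds (σ.current α) l) || decide (ListSat (σ.current α) c)) := by
      simp [ListSat]
    rw [e]
    refine Runs.mono (Runs.condCons (.pure rfl rfl) hor) ?_
    norm_num [Expr.size]; nlinarith

theorem within_runs (xs : List (Status n)) (r : ℕ) :
    Runs ℙ [.cons (Tree.ofList Status.enc xs) (Tree.ofNat r)] withinBody
      (Tree.ofBool (decide (xs.countP Status.flipped ≤ r))) (40 * (xs.length + 1)) := by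
  induction xs generalizing r with
  | nil =>
    refine Runs.mono (Runs.condNil (.pure rfl rfl) (Runs.pure rfl ?_)) ?_
    · simp [Tree.ofBool, Expr.value]
    · norm_num [Expr.size]
  | cons s xs ih =>
    have hs := s.hd_enc
    have hx : (0 : ℝ) ≤ xs.length := Nat.cast_nonneg _
    have hh : Runs ℙ [.cons (Tree.ofList Status.enc (s :: xs)) (Tree.ofNat r)]
        (.hd (.hd (.hd .arg))) (Tree.ofBool s.flipped) _ := Runs.pure rfl hs
    cases hf : s.flipped
    · rw [hf] at hh
      have e : (s :: xs).countP Status.flipped = xs.countP Status.flipped := by simp [hf]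
      rw [e]
      refine Runs.mono (Runs.condCons (.pure rfl rfl) (Runs.condNil hh
        (Runs.call rfl (.pure rfl rfl) (ih r)))) ?_
      norm_num [Expr.size]; linarith
    · rw [hf] at hh
      have e : (s :: xs).countP Status.flipped = xs.countP Status.flipped + 1 := by simp [hf]
      rw [e]
      cases r with
      | zero =>
        refine Runs.mono (Runs.condCons (.pure rfl rfl) (Runs.condCons hh
          (Runs.condNil (.pure rfl rfl) (Runs.pure rfl ?_)))) ?_
        · simp [Tree.ofBool, Expr.value]
        · norm_num [Expr.size]; linarith
      | succ r =>
        simp only [Nat.add_le_add_iff_right]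
        refine Runs.mono (Runs.condCons (.pure rfl rfl) (Runs.condCons hh
          (Runs.condCons (.pure rfl rfl) (Runs.call rfl (.pure rfl rfl) (ih r))))) ?_
        norm_num [Expr.size]; linarith

/-- The initial state. -/
def State.init (n : ℕ) : State n := fun _ => .out

theorem zeros_runs (bs : List Bool) :
    Runs ℙ [Tree.ofList Tree.ofBool bs] zerosBody
      (Tree.ofList Status.enc (bs.map fun _ => (.out : Status n))) (10 * (bs.length + 1)) := by
  induction bs with
  | nil =>
    refine Runs.mono (Runs.condNil (.pure rfl rfl) (.pure rfl rfl)) ?_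
    norm_num [Expr.size]
  | cons b bs ih =>
    refine Runs.mono (Runs.condCons (.pure rfl rfl)
      (Runs.cons (.pure rfl rfl) (Runs.call rfl (.pure rfl rfl) ih))) ?_
    norm_num [Expr.size]; linarith

theorem init_runs (α : Assignment n) :
    Runs ℙ [encAssignment α] zerosBody (State.init n).enc (10 * (n + 1)) := by
  have h := zeros_runs (K := K) (table := table) (n := n) (List.ofFn α)
  simp only [List.length_ofFn] at h
  have e : (List.ofFn α).map (fun _ => (.out : Status n)) = List.ofFn (State.init n) :=
    List.ext_getElem (by simp) (by simp [State.init])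
  rw [e] at h
  exact h

theorem numeral_isPure (k : ℕ) : (numeral k).isPure = true := by
  induction k with
  | zero => rfl
  | succ k ih => simpa [numeral, Expr.isPure] using ih

theorem numeral_value (env : List Tree) (k : ℕ) : (numeral k).value env = Tree.ofNat k := by
  induction k with
  | zero => rfl
  | succ k ih => simp [numeral, Expr.value, Tree.ofNat, ih]

theorem numeral_size (k : ℕ) : (numeral k).size = 2 * k + 1 := by
  induction k with
  | zero => rfl
  | succ k ih => simp only [numeral, Expr.size, ih]; ring

theorem double_runs (r : ℕ) :
    Runs ℙ [Tree.ofNat r] (doubleBody K) (Tree.ofNat (2 * r + K)) (10 * (r + K + 1)) := by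
  induction r with
  | zero =>
    refine Runs.mono (Runs.condNil (.pure rfl rfl)
      (Runs.pure (numeral_isPure K) ?_)) ?_
    · simp [numeral_value]
    · norm_num [Expr.size, numeral_size]; linarith [(Nat.cast_nonneg K : (0 : ℝ) ≤ K)]
  | succ r ih =>
    rw [show 2 * (r + 1) + K = (2 * r + K) + 1 + 1 by ring]
    refine Runs.mono (Runs.condCons (.pure rfl rfl) (Runs.cons (.pure rfl rfl)
      (Runs.cons (.pure rfl rfl) (Runs.call rfl (.pure rfl rfl) ih)))) ?_
    norm_num [Expr.size]; linarith

theorem negs_runs (α : Assignment n) (σ : State n) (L : List (List (Literal n)))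
    (hL : ∀ c ∈ L, c.length ≤ 3) :
    Runs ℙ [.cons σ.enc (.cons (encAssignment α) (encFormula L))] negsBody
      (encFormula (L.filter fun c => !decide (ListSat (σ.current α) c)))
      (700 * (n + 1) * (L.length + 1)) := by
  have hn : (0 : ℝ) ≤ n := n.cast_nonneg
  induction L with
  | nil =>
    refine Runs.mono (Runs.condNil (.pure rfl rfl) (.pure rfl rfl)) ?_
    norm_num [Expr.size]; linarith
  | cons c L ih =>
    have hc := csat_runs (K := K) (table := table) α σ c
    have hlen : (c.length : ℝ) ≤ 3 := by exact_mod_cast hL c (by simp)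
    have ih := ih fun c hc => hL c (by simp [hc])
    have hb : 150 * ((n : ℝ) + 1) * (c.length + 1) ≤ 600 * (n + 1) := by nlinarith
    by_cases h : ListSat (σ.current α) c
    · rw [decide_eq_true h] at hc
      rw [List.filter_cons_of_neg (by simp [h])]
      refine Runs.mono (Runs.condCons (.pure rfl rfl) (Runs.condCons
        (Runs.call rfl (.pure rfl rfl) hc) (Runs.call rfl (.pure rfl rfl) ih))) ?_
      norm_num [Expr.size]; nlinarith
    · rw [decide_eq_false h] at hc
      rw [List.filter_cons_of_pos (by simp [h])]
      refine Runs.mono (Runs.condCons (.pure rfl rfl) (Runs.condNil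
        (Runs.call rfl (.pure rfl rfl) hc) (Runs.cons (.pure rfl rfl)
          (Runs.call rfl (.pure rfl rfl) ih)))) ?_
      norm_num [Expr.size]; nlinarith

/-- Make `x` a core with sides `y` and `z`. -/
def State.openBlock (σ : State n) (x y z : Fin n) : State n :=
  Function.update (Function.update (Function.update σ z (.side x y)) y (.side x z)) x (.core y z)

theorem open_runs (σ : State n) (x y z : Literal n) :
    Runs ℙ [.cons (Tree.ofLiteral x) (.cons (Tree.ofLiteral y) (.cons (Tree.ofLiteral z) σ.enc))]
      openBody (σ.openBlock x.1 y.1 z.1).enc (300 * (n + 1)) := by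
  have hn : (0 : ℝ) ≤ n := n.cast_nonneg
  have h₁ := setState_runs (K := K) (table := table) σ z.1 (.side x.1 y.1)
  have h₂ := setState_runs (K := K) (table := table)
    (Function.update σ z.1 (.side x.1 y.1)) y.1 (.side x.1 z.1)
  have h₃ := setState_runs (K := K) (table := table)
    (Function.update (Function.update σ z.1 (.side x.1 y.1)) y.1 (.side x.1 z.1)) x.1
    (.core y.1 z.1)
  refine Runs.mono (Runs.condCons (.pure rfl rfl) (Runs.call rfl (.cons (.pure rfl rfl)
    (.cons (.pure rfl rfl) (Runs.call rfl (.cons (.pure rfl rfl) (.cons (.pure rfl rfl)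
      (Runs.call rfl (.pure rfl rfl) h₁))) h₂))) h₃)) ?_
  norm_num [Expr.size, Expr.drop]; linarith

theorem open_nil_runs (t : Tree) :
    Runs ℙ [.cons .nil (.cons .nil (.cons .nil t))] openBody t 20 := by
  refine Runs.mono (Runs.condNil (.pure rfl rfl) (.pure rfl rfl)) ?_
  norm_num [Expr.size, Expr.drop]

end Auxiliary

/-! ### Iterated tails of numerals and lists -/

theorem Expr.drop_isPure {e : Expr} (h : e.isPure = true) (d : ℕ) : (e.drop d).isPure = true := by
  induction d with
  | zero => exact h
  | succ d ih => exact ih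

theorem Expr.drop_size (e : Expr) (d : ℕ) : (e.drop d).size = e.size + d := by
  induction d with
  | zero => rfl
  | succ d ih => simp only [Expr.drop, Expr.size, ih]; ring

theorem Expr.drop_value_ofNat {env : List Tree} {e : Expr} {W : ℕ}
    (h : e.value env = Tree.ofNat W) (d : ℕ) : (e.drop d).value env = Tree.ofNat (W - d) := by
  induction d with
  | zero => exact h
  | succ d ih =>
    simp only [Expr.drop, Expr.value, ih, Nat.sub_add_eq]
    cases W - d <;> rfl

theorem Expr.drop_value_ofList {A : Type} {enc : A → Tree} {env : List Tree} {e : Expr}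
    {xs : List A} (h : e.value env = Tree.ofList enc xs) (d : ℕ) :
    (e.drop d).value env = Tree.ofList enc (xs.drop d) := by
  induction d with
  | zero => exact h
  | succ d ih =>
    simp only [Expr.drop, Expr.value, ih]
    rw [← List.tail_drop]
    cases xs.drop d <;> rfl

/-! ### Validity and weight of the states -/

section States

variable {n : ℕ}

/-- All literals of the clause are false under `α`. -/
def IsNeg (α : Assignment n) (c : List (Literal n)) : Prop := ¬ ListSat α c

/-- The variable `i` occurs in the clause. -/
def HasVar (c : List (Literal n)) (i : Fin n) : Prop := ∃ l ∈ c, l.1 = i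

/-- The clauses of `L` that are false under `α` have three variables each and are pairwise
disjoint. -/
structure DisjointTriples (α : Assignment n) (L : List (List (Literal n))) : Prop where
  triple : ∀ c ∈ L, IsNeg α c →
    ∃ l : Fin 3 → Literal n, c = List.ofFn l ∧ Function.Injective fun j => (l j).1
  disjoint : ∀ c ∈ L, ∀ d ∈ L, IsNeg α c → IsNeg α d → ∀ i, HasVar c i → HasVar d i → c = d

/-- The states that occur when the clauses in `bs` are still to be opened. -/
structure Valid (α : Assignment n) (L bs : List (List (Literal n))) (σ : State n) : Prop where
  core : ∀ i y z, σ i = .core y z → y ≠ z ∧ i ≠ y ∧ i ≠ z ∧ σ y = .side i z ∧ σ z = .side i y ∧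
    ∀ c ∈ L, IsNeg α c → HasVar c i → HasVar c y ∧ HasVar c z
  side : ∀ y x z, σ y = .side x z → σ x = .core y z ∨ σ x = .core z y
  flipped : ∀ c ∈ L, IsNeg α c → (∃ i, HasVar c i ∧ (σ i).flipped = true) ∨ c ∈ bs
  nodup : bs.Nodup
  mem : ∀ b ∈ bs, b ∈ L ∧ IsNeg α b ∧ ∀ i, HasVar b i → σ i = .out

/-- What a core and its sides cost, if `p`, `q`, `z` tell which of them have to be flipped. -/
def openCost (p q z : Bool) : ℕ :=
  if p then (if q && z then 5 else if q || z then 3 else 0) else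
    (if q && z then 7 else if q || z then 5 else 0)

/-- The part of the variable `i` in the weight. -/
def localWeight (σ : State n) (X : Fin n → Bool) (i : Fin n) : ℕ :=
  match σ i with
  | .out => if X i then 2 else 0
  | .core y z => openCost (X i) (X y) (X z)
  | _ => 0

/-- The budget that the search needs for finding, from `σ`, the assignment that differs from `α`
in `X`. -/
def weight (σ : State n) (X : Fin n → Bool) : ℕ := ∑ i, localWeight σ X i

/-- The decisions made in `σ` agree with `X`. -/
def Compatible (σ : State n) (X : Fin n → Bool) : Prop :=
  ∀ i, (σ i = .yes → X i = true) ∧ (σ i = .no → X i = false) ∧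
    ∀ y z, σ i = .core y z → X i = true ∨ X y = true ∨ X z = true

theorem openCost_comm (p q z : Bool) : openCost p q z = openCost p z q := by
  revert p q z; decide

/-- Opening or settling a clause changes the status of three variables only; the additive form
avoids subtraction of natural numbers. -/
theorem sum_add_of_eq_off_triple {f g : Fin n → ℕ} {p q z : Fin n} (hpq : p ≠ q) (hpz : p ≠ z)
    (hqz : q ≠ z) (h : ∀ i, i ≠ p → i ≠ q → i ≠ z → g i = f i) :
    ∑ i, g i + (f p + f q + f z) = ∑ i, f i + (g p + g q + g z) := by
  have key : ∀ k : Fin n → ℕ,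
      ∑ i, k i = (k p + k q + k z) + ∑ i ∈ Finset.univ \ {p, q, z}, k i := by
    intro k
    rw [← Finset.sum_sdiff (Finset.subset_univ {p, q, z}), add_comm,
      Finset.sum_insert (by simp [hpq, hpz]), Finset.sum_insert (by simp [hqz]),
      Finset.sum_singleton, ← add_assoc]
  rw [key f, key g, Finset.sum_congr rfl (g := f)]
  · ring
  · intro i hi
    simp only [Finset.mem_sdiff, Finset.mem_insert, Finset.mem_singleton, not_or] at hi
    exact h i hi.2.1 hi.2.2.1 hi.2.2.2

/-! ### Settling an open clause and flipping an open variable -/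

/-- Close an open clause: the core `p` becomes `a`, the side `q` becomes `yes`, and the side `z`
becomes `out`. -/
def State.settle (σ : State n) (p : Fin n) (a : Status n) (q z : Fin n) : State n :=
  Function.update (Function.update (Function.update σ z .out) q .yes) p a

variable {α : Assignment n} {L bs : List (List (Literal n))} {σ : State n} {X : Fin n → Bool}

theorem Valid.core_symm (h : Valid α L bs σ) {p q z : Fin n}
    (hp : σ p = .core q z ∨ σ p = .core z q) :
    q ≠ z ∧ p ≠ q ∧ p ≠ z ∧ σ q = .side p z ∧ σ z = .side p q ∧
      ∀ c ∈ L, IsNeg α c → HasVar c p → HasVar c q ∧ HasVar c z := by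
  obtain hp | hp := hp
  · exact h.core _ _ _ hp
  · obtain ⟨h₁, h₂, h₃, h₄, h₅, h₆⟩ := h.core _ _ _ hp
    exact ⟨h₁.symm, h₃, h₂, h₅, h₄, fun c hc hn hv => (h₆ c hc hn hv).symm⟩

theorem State.settle_apply (σ : State n) (p : Fin n) (a : Status n) (q z i : Fin n) :
    σ.settle p a q z i = if i = p then a else if i = q then .yes else if i = z then .out else σ i := by
  simp only [State.settle, Function.update_apply]

/-- Even if the core is withdrawn, each clause false under `α` keeps a flipped variable: if it
contains `p` it also contains `q`, which is flipped now. -/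
theorem Valid.settle (h : Valid α L [] σ) {p q z : Fin n}
    (hp : σ p = .core q z ∨ σ p = .core z q) {a : Status n} (ha : a = .no ∨ a = .yes) :
    Valid α L [] (σ.settle p a q z) := by
  obtain ⟨hqz, hpq, hpz, hq, hz, hc⟩ := h.core_symm hp
  have hac : ∀ y z, a ≠ .core y z := by rintro y z rfl; simp at ha
  have has : ∀ y z, a ≠ .side y z := by rintro y z rfl; simp at ha
  constructor
  · intro i y w hi
    rw [State.settle_apply] at hi
    split_ifs at hi with h₁ h₂ h₃
    · exact absurd hi (hac _ _)
    obtain ⟨k₁, k₂, k₃, k₄, k₅, k₆⟩ := h.core _ _ _ hi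
    refine ⟨k₁, k₂, k₃, ?_, ?_, k₆⟩
    · rw [State.settle_apply, if_neg, if_neg, if_neg, k₄]
      · rintro rfl; simp [k₄, h₁] at hz
      · rintro rfl; simp [k₄, h₁] at hq
      · rintro rfl; simp [k₄] at hp
    · rw [State.settle_apply, if_neg, if_neg, if_neg, k₅]
      · rintro rfl; simp [k₅, h₁] at hz
      · rintro rfl; simp [k₅, h₁] at hq
      · rintro rfl; simp [k₅] at hp
  · intro y x w hy
    rw [State.settle_apply] at hy
    split_ifs at hy with h₁ h₂ h₃
    · exact absurd hy (has _ _)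
    have k := h.side _ _ _ hy
    -- The core `p` has only the sides `q` and `z`, and `y` is neither.
    have hxp : x ≠ p := by
      rintro rfl
      rcases hp with hp | hp <;> rcases k with k | k <;> simp [hp] at k <;> aesop
    have hxq : x ≠ q := by rintro rfl; simp [hq] at k
    have hxz : x ≠ z := by rintro rfl; simp [hz] at k
    simpa [State.settle_apply, hxp, hxq, hxz] using k
  · intro c hcL hn
    left
    obtain ⟨i, hi, hf⟩ := (h.flipped c hcL hn).resolve_right (by simp)
    by_cases hip : i = p
    · subst hip
      refine ⟨q, (hc c hcL hn hi).1, ?_⟩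
      simp [State.settle_apply, hpq.symm, Status.flipped]
    -- A flipped variable other than `p` stays flipped, because the only other one reset to an
    -- unflipped status is the side `z`, which was not flipped before.
    · have hiz : i ≠ z := by rintro rfl; simp [hz, Status.flipped] at hf
      refine ⟨i, hi, ?_⟩
      rw [State.settle_apply, if_neg hip, if_neg hiz]
      split_ifs
      · rfl
      · exact hf
  · exact List.nodup_nil
  · simp

/-- This is what `openCost` is made for: once the side `q` is known to be flipped, the cost is 5
without the core and 3 with it, plus 2 if `z` has to be flipped too. The last 2 is exactly the
weight of `z` as an `out` variable. -/
theorem Valid.settle_spec (h : Valid α L bs σ) {p q z : Fin n}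
    (hp : σ p = .core q z ∨ σ p = .core z q) (hX : Compatible σ X) (hq : X q = true)
    {a : Status n} {d : ℕ}
    (ha : (a = .no ∧ X p = false ∧ d = 5) ∨ (a = .yes ∧ X p = true ∧ d = 3)) :
    Compatible (σ.settle p a q z) X ∧ weight (σ.settle p a q z) X + d = weight σ X := by
  obtain ⟨hqz, hpq, hpz, hq', hz, hc⟩ := h.core_symm hp
  constructor
  · intro i
    rw [State.settle_apply]
    split_ifs with h₁ h₂ h₃
    · subst h₁
      rcases ha with ⟨rfl, h, _⟩ | ⟨rfl, h, _⟩ <;> simp [h]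
    · subst h₂; simp [hq]
    · simp
    · exact hX i
  · have key := sum_add_of_eq_off_triple (f := localWeight σ X)
      (g := localWeight (σ.settle p a q z) X) hpq hpz hqz (by
        intro i h₁ h₂ h₃
        simp [localWeight, State.settle_apply, h₁, h₂, h₃])
    have e₁ : localWeight σ X p = openCost (X p) true (X z) := by
      rcases hp with hp | hp <;> simp [localWeight, hp, hq, openCost_comm _ (X z) true]
    have e₂ : localWeight σ X q = 0 := by simp [localWeight, hq']
    have e₃ : localWeight σ X z = 0 := by simp [localWeight, hz]
    have e₄ : localWeight (σ.settle p a q z) X p = 0 := by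
      rcases ha with ⟨rfl, _⟩ | ⟨rfl, _⟩ <;> simp [localWeight, State.settle_apply]
    have e₅ : localWeight (σ.settle p a q z) X q = 0 := by
      simp [localWeight, State.settle_apply, hpq.symm]
    have e₆ : localWeight (σ.settle p a q z) X z = if X z then 2 else 0 := by
      simp [localWeight, State.settle_apply, hpz.symm, hqz.symm]
    rw [e₁, e₂, e₃, e₄, e₅, e₆] at key
    change _ + _ = ∑ i, _
    unfold weight
    rcases ha with ⟨rfl, hx, rfl⟩ | ⟨rfl, hx, rfl⟩ <;> rw [hx] at key <;> cases hz : X z <;>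
      simp [hz, openCost] at key <;> omega

/-- A variable with status `out` belongs to no open clause, so the links between cores and sides are
untouched, and the flip only adds a flipped variable. -/
theorem Valid.update_yes (h : Valid α L [] σ) {i : Fin n} (hi : σ i = .out) :
    Valid α L [] (Function.update σ i .yes) := by
  have key : ∀ j (s : Status n), s ≠ .out → σ j = s → Function.update σ i .yes j = s := by
    intro j s hs hj
    rw [Function.update_of_ne (by rintro rfl; exact hs (hj.symm.trans hi)), hj]
  have back : ∀ j (s : Status n), s ≠ .yes → Function.update σ i .yes j = s → σ j = s := by
    intro j s hs hj
    rw [Function.update_apply] at hj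
    split_ifs at hj with hji
    · exact absurd hj.symm hs
    · exact hj
  constructor
  · intro j y z hj
    obtain ⟨k₁, k₂, k₃, k₄, k₅, k₆⟩ := h.core _ _ _ (back _ _ (by simp) hj)
    exact ⟨k₁, k₂, k₃, key _ _ (by simp) k₄, key _ _ (by simp) k₅, k₆⟩
  · intro y x z hy
    exact (h.side _ _ _ (back _ _ (by simp) hy)).imp (key _ _ (by simp)) (key _ _ (by simp))
  · intro c hcL hn
    obtain ⟨j, hj, hf⟩ := (h.flipped c hcL hn).resolve_right (by simp)
    refine .inl ⟨j, hj, ?_⟩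
    rw [Function.update_apply]
    split_ifs
    · rfl
    · exact hf
  · exact List.nodup_nil
  · simp

theorem update_yes_spec {i : Fin n} (hi : σ i = .out) (hX : Compatible σ X) (hXi : X i = true) :
    Compatible (Function.update σ i .yes) X ∧
      weight (Function.update σ i .yes) X + 2 = weight σ X := by
  constructor
  · intro j
    rw [Function.update_apply]
    split_ifs with hji
    · subst hji; simp [hXi]
    · exact hX j
  · unfold weight
    rw [← Finset.add_sum_erase _ _ (Finset.mem_univ i),
      ← Finset.add_sum_erase _ (localWeight σ X) (Finset.mem_univ i),
      Finset.sum_congr rfl (g := localWeight σ X)]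
    · have h₁ : localWeight σ X i = 2 := by simp [localWeight, hi, hXi]
      have h₂ : localWeight (Function.update σ i .yes) X i = 0 := by simp [localWeight]
      rw [h₁, h₂]; ring
    · intro j hj
      simp [localWeight, Function.update_of_ne (Finset.ne_of_mem_erase hj)]

/-! ### Opening a clause -/

/-- Open a clause that is given by its three literals. -/
def State.openAt (σ : State n) (l : Fin 3 → Literal n) (j : Fin 3) : State n :=
  σ.openBlock (l j).1 (l (j + 1)).1 (l (j + 2)).1

theorem hasVar_ofFn {l : Fin 3 → Literal n} (i : Fin 3) : HasVar (List.ofFn l) (l i).1 :=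
  ⟨l i, (List.mem_ofFn' _ _).2 ⟨i, rfl⟩, rfl⟩

theorem eq_or_eq_add (j k : Fin 3) : k = j ∨ k = j + 1 ∨ k = j + 2 := by
  revert j k; decide

theorem hasVar_ofFn_iff {l : Fin 3 → Literal n} (j : Fin 3) (i : Fin n) :
    HasVar (List.ofFn l) i ↔ i = (l j).1 ∨ i = (l (j + 1)).1 ∨ i = (l (j + 2)).1 := by
  constructor
  · rintro ⟨_, hm, rfl⟩
    obtain ⟨k, rfl⟩ := (List.mem_ofFn' _ _).1 hm
    rcases eq_or_eq_add j k with rfl | rfl | rfl <;> simp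
  · rintro (rfl | rfl | rfl) <;> exact hasVar_ofFn _

theorem rotation_ne {l : Fin 3 → Literal n} (hl : Function.Injective fun j => (l j).1) (j : Fin 3) :
    (l j).1 ≠ (l (j + 1)).1 ∧ (l j).1 ≠ (l (j + 2)).1 ∧ (l (j + 1)).1 ≠ (l (j + 2)).1 :=
  have h : ∀ j : Fin 3, j ≠ j + 1 ∧ j ≠ j + 2 ∧ j + 1 ≠ j + 2 := by decide
  ⟨fun e => (h j).1 (hl e), fun e => (h j).2.1 (hl e), fun e => (h j).2.2 (hl e)⟩

theorem State.openBlock_apply (σ : State n) (x y z i : Fin n) :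
    σ.openBlock x y z i =
      if i = x then .core y z else if i = y then .side x z else if i = z then .side x y else σ i := by
  simp only [State.openBlock, Function.update_apply]

/-- Disjointness enters twice: a clause false under `α` that contains the new core is the opened
clause itself, and the clauses still to be opened are not touched. -/
theorem Valid.openAt (hL : DisjointTriples α L) {l : Fin 3 → Literal n}
    (hl : Function.Injective fun j => (l j).1) (h : Valid α L (List.ofFn l :: bs) σ) (j : Fin 3) :
    Valid α L bs (σ.openAt l j) := by
  obtain ⟨hxy, hxz, hyz⟩ := rotation_ne hl j
  obtain ⟨hbL, hbn, hbo⟩ := h.mem _ List.mem_cons_self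
  have hv := hasVar_ofFn_iff (l := l) j
  unfold State.openAt
  generalize (l j).1 = x at *
  generalize (l (j + 1)).1 = y at *
  generalize (l (j + 2)).1 = z at *
  have hx : σ x = .out := hbo x ((hv x).2 (by simp))
  have hy : σ y = .out := hbo y ((hv y).2 (by simp))
  have hz : σ z = .out := hbo z ((hv z).2 (by simp))
  have key : ∀ i (s : Status n), s ≠ .out → σ i = s → σ.openBlock x y z i = s := by
    intro i s hs hi
    rw [State.openBlock_apply, if_neg, if_neg, if_neg, hi]
    · rintro rfl; exact hs (hi.symm.trans hz)
    · rintro rfl; exact hs (hi.symm.trans hy)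
    · rintro rfl; exact hs (hi.symm.trans hx)
  constructor
  · intro i u w hi
    rw [State.openBlock_apply] at hi
    split_ifs at hi with h₁ h₂ h₃
    · obtain ⟨rfl, rfl⟩ := Status.core.inj hi
      subst h₁
      refine ⟨hyz, hxy, hxz, ?_, ?_, ?_⟩
      · simp [State.openBlock_apply, hxy.symm]
      · simp [State.openBlock_apply, hxz.symm, hyz.symm]
      · intro c hc hn hci
        rw [hL.disjoint c hc _ hbL hn hbn i hci ((hv i).2 (by simp))]
        exact ⟨(hv _).2 (by simp), (hv _).2 (by simp)⟩
    · obtain ⟨k₁, k₂, k₃, k₄, k₅, k₆⟩ := h.core _ _ _ hi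
      exact ⟨k₁, k₂, k₃, key _ _ (by simp) k₄, key _ _ (by simp) k₅, k₆⟩
  · intro i u w hi
    rw [State.openBlock_apply] at hi
    split_ifs at hi with h₁ h₂ h₃
    · obtain ⟨rfl, rfl⟩ := Status.side.inj hi
      left; simp [State.openBlock_apply, h₂]
    · obtain ⟨rfl, rfl⟩ := Status.side.inj hi
      right; simp [State.openBlock_apply, h₃]
    · exact (h.side _ _ _ hi).imp (key _ _ (by simp)) (key _ _ (by simp))
  · intro c hc hn
    obtain ⟨i, hi, hf⟩ | hm := h.flipped c hc hn
    · refine .inl ⟨i, hi, ?_⟩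
      rw [key i _ (by intro h; simp [h, Status.flipped] at hf) rfl]
      exact hf
    · rcases List.mem_cons.1 hm with rfl | hm
      · exact .inl ⟨x, (hv x).2 (by simp), by simp [State.openBlock_apply, Status.flipped]⟩
      · exact .inr hm
  · exact (List.nodup_cons.1 h.nodup).2
  · intro b hb
    obtain ⟨k₁, k₂, k₃⟩ := h.mem b (by simp [hb])
    refine ⟨k₁, k₂, fun i hi => ?_⟩
    -- A common variable would make the two clauses equal, against `nodup`.
    have : ¬ HasVar (List.ofFn l) i := fun hi' =>
      (List.nodup_cons.1 h.nodup).1 (hL.disjoint _ hbL _ k₁ hbn k₂ i hi' hi ▸ hb)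
    rw [hv, not_or, not_or] at this
    rw [State.openBlock_apply, if_neg this.1, if_neg this.2.1, if_neg this.2.2, k₃ i hi]

/-- The number of elements of a set of positions. -/
def count3 (S : Fin 3 → Bool) : ℕ := ∑ j, if S j then 1 else 0

theorem openAt_spec {l : Fin 3 → Literal n} (hl : Function.Injective fun j => (l j).1)
    (ho : ∀ j, σ (l j).1 = .out) (hX : Compatible σ X) (hS : ∃ j, X (l j).1 = true) (j : Fin 3) :
    Compatible (σ.openAt l j) X ∧
      weight (σ.openAt l j) X + 2 * count3 (fun j => X (l j).1) =
        weight σ X + openCost (X (l j).1) (X (l (j + 1)).1) (X (l (j + 2)).1) := by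
  obtain ⟨hxy, hxz, hyz⟩ := rotation_ne hl j
  have hcount : count3 (fun j => X (l j).1) = (if X (l j).1 then 1 else 0) +
      (if X (l (j + 1)).1 then 1 else 0) + (if X (l (j + 2)).1 then 1 else 0) := by
    unfold count3
    rw [Fin.sum_univ_three]
    fin_cases j
    · rfl
    · simp only [Fin.mk_one, Fin.isValue, Fin.reduceAdd]; ring
    · simp only [Fin.reduceFinMk, Fin.isValue, Fin.reduceAdd]; ring
  have hS' : X (l j).1 = true ∨ X (l (j + 1)).1 = true ∨ X (l (j + 2)).1 = true := by
    obtain ⟨k, hk⟩ := hS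
    rcases eq_or_eq_add j k with rfl | rfl | rfl <;> simp [hk]
  rw [hcount]
  have hx := ho j
  have hy := ho (j + 1)
  have hz := ho (j + 2)
  unfold State.openAt
  generalize (l j).1 = x at *
  generalize (l (j + 1)).1 = y at *
  generalize (l (j + 2)).1 = z at *
  constructor
  · intro i
    rw [State.openBlock_apply]
    split_ifs with h₁ h₂ h₃
    · subst h₁
      refine ⟨by simp, by simp, fun u w h => ?_⟩
      obtain ⟨rfl, rfl⟩ := Status.core.inj h
      exact hS'
    · simp
    · simp
    · exact hX i
  · have key := sum_add_of_eq_off_triple (f := localWeight σ X)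
      (g := localWeight (σ.openBlock x y z) X) hxy hxz hyz (by
        intro i h₁ h₂ h₃
        simp [localWeight, State.openBlock_apply, h₁, h₂, h₃])
    have e₁ : localWeight (σ.openBlock x y z) X x = openCost (X x) (X y) (X z) := by
      simp [localWeight, State.openBlock_apply]
    have e₂ : localWeight (σ.openBlock x y z) X y = 0 := by
      simp [localWeight, State.openBlock_apply, hxy.symm]
    have e₃ : localWeight (σ.openBlock x y z) X z = 0 := by
      simp [localWeight, State.openBlock_apply, hxz.symm, hyz.symm]
    have e₄ : ∀ i, σ i = .out → localWeight σ X i = if X i then 2 else 0 := by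
      intro i hi; simp [localWeight, hi]
    rw [e₁, e₂, e₃, e₄ x hx, e₄ y hy, e₄ z hz] at key
    unfold weight
    revert key
    generalize ∑ i, localWeight (σ.openBlock x y z) X i = w
    generalize ∑ i, localWeight σ X i = w'
    cases X x <;> cases X y <;> cases X z <;> simp [openCost]

/-! ### False clauses and the number of flips -/

/-- A clause that is false at present has a literal that is true under `α`. -/
theorem Valid.exists_pos (h : Valid α L [] σ) {c : List (Literal n)} (hc : c ∈ L)
    (hs : ¬ ListSat (σ.current α) c) : ListSat α c := by
  by_contra hn
  obtain ⟨_, ⟨l, hl, rfl⟩, hf⟩ := (h.flipped c hc hn).resolve_right (by simp)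
  refine hs ⟨l, hl, ?_⟩
  have : ¬ α l.1 = l.2 := fun h => hn ⟨l, hl, h⟩
  unfold Literal.Holds State.current
  rw [hf]
  revert this
  cases α l.1 <;> cases l.2 <;> simp

theorem hammingDist_current (α : Assignment n) (σ : State n) :
    hammingDist α (σ.current α) = (List.ofFn σ).countP Status.flipped := by
  have e : ∀ i, (α i ≠ σ.current α i) ↔ (σ i).flipped = true := by
    intro i
    unfold State.current
    cases α i <;> cases (σ i).flipped <;> simp
  unfold hammingDist
  simp only [e]
  rw [List.ofFn_eq_map, List.countP_map, List.countP_eq_length_filter]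
  rw [← List.toFinset_card_of_nodup ((List.nodup_finRange n).filter _)]
  congr 1
  ext i
  simp

/-- At most as many variables are flipped as have to be flipped in the end. -/
theorem Valid.countP_le (h : Valid α L bs σ) (hX : Compatible σ X) :
    (List.ofFn σ).countP Status.flipped ≤ (Finset.univ.filter fun i => X i = true).card := by
  rw [← hammingDist_current α]
  unfold hammingDist
  have e : ∀ i, (α i ≠ σ.current α i) ↔ (σ i).flipped = true := by
    intro i
    unfold State.current
    cases α i <;> cases (σ i).flipped <;> simp
  simp only [e]
  -- Charge each flipped variable to one that `X` flips: a core to a variable of its own clause, a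
  -- decided flip to itself. The map is injective because a side records its core and is not itself
  -- flipped.
  let g : Fin n → Fin n := fun i => match σ i with
    | .core y z => if X i then i else if X y then y else z
    | _ => i
  have hg : ∀ i, (σ i).flipped = true → X (g i) = true ∧
      ((g i = i) ∨ ∃ w, σ (g i) = .side i w) := by
    intro i hi
    cases hs : σ i with
    | out | no | side => simp [hs, Status.flipped] at hi
    | yes => exact ⟨by simp only [g, hs]; exact (hX i).1 hs, .inl (by simp only [g, hs])⟩
    | core y z =>
      obtain ⟨-, -, -, k₁, k₂, -⟩ := h.core _ _ _ hs
      have k := (hX i).2.2 y z hs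
      simp only [g, hs]
      split_ifs with h₁ h₂
      · exact ⟨h₁, .inl rfl⟩
      · exact ⟨h₂, .inr ⟨_, k₁⟩⟩
      · exact ⟨by simpa [h₁, h₂] using k, .inr ⟨_, k₂⟩⟩
  refine Finset.card_le_card_of_injOn g ?_ ?_
  · intro i hi
    simp only [Finset.coe_filter, Finset.mem_univ, true_and, Set.mem_ofPred_eq] at hi ⊢
    exact (hg i hi).1
  · intro i hi k hk hik
    simp only [Finset.coe_filter, Finset.mem_univ, true_and, Set.mem_ofPred_eq] at hi hk
    obtain ⟨-, hi'⟩ := hg i hi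
    obtain ⟨-, hk'⟩ := hg k hk
    rw [← hik] at hk'
    rcases hi' with hi' | ⟨w, hi'⟩ <;> rcases hk' with hk' | ⟨w', hk'⟩
    · exact hi'.symm.trans hk'
    · rw [hi'] at hk'; simp [hk', Status.flipped] at hi
    · rw [hk'] at hi'; simp [hi', Status.flipped] at hk
    · rw [hi'] at hk'; simpa using (Status.side.inj hk').1

end States

/-! ### Covering codes -/

/-- Greedy covering: if every point of `s` is hit by at least a fraction `f` of all codewords, then
`M` codewords suffice to hit all but a fraction `(1 - f) ^ M`. -/
theorem exists_cover {C Y : Type} [Fintype C] [DecidableEq Y] (R : C → Y → Prop)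
    [∀ c y, Decidable (R c y)] [Nonempty C] (f : ℝ) (s : Finset Y)
    (hs : ∀ y ∈ s, f * Fintype.card C ≤ (Finset.univ.filter fun c => R c y).card) (M : ℕ)
    (hf : f ≤ 1) :
    ∃ l : List C, l.length = M ∧
      ((s.filter fun y => ∀ c ∈ l, ¬ R c y).card : ℝ) ≤ (1 - f) ^ M * s.card := by
  induction M with
  | zero => exact ⟨[], rfl, by simp⟩
  | succ M ih =>
    obtain ⟨l, hl, hc⟩ := ih
    set u := s.filter fun y => ∀ c ∈ l, ¬ R c y with hu
    have hC : (0 : ℝ) < Fintype.card C := by exact_mod_cast Fintype.card_pos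
    -- Double counting of the hits: some codeword hits at least the average, a fraction `f` of the
    -- points still uncovered.
    have double : ∑ c : C, ((u.filter fun y => R c y).card : ℝ) =
        ∑ y ∈ u, ((Finset.univ.filter fun c => R c y).card : ℝ) := by
      simp only [Finset.card_filter, Nat.cast_sum]
      rw [Finset.sum_comm]
    obtain ⟨c, -, hcov⟩ : ∃ c ∈ (Finset.univ : Finset C),
        f * u.card ≤ ((u.filter fun y => R c y).card : ℝ) := by
      apply Finset.exists_le_of_sum_le Finset.univ_nonempty
      rw [double, Finset.sum_const, Finset.card_univ, nsmul_eq_mul]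
      calc (Fintype.card C : ℝ) * (f * u.card) = ∑ y ∈ u, f * Fintype.card C := by
            rw [Finset.sum_const, nsmul_eq_mul]; ring
        _ ≤ _ := Finset.sum_le_sum fun y hy => hs y (Finset.mem_of_mem_filter y hy)
    refine ⟨c :: l, by simp [hl], ?_⟩
    have e : (s.filter fun y => ∀ c' ∈ c :: l, ¬ R c' y) = u.filter fun y => ¬ R c y := by
      rw [hu, Finset.filter_filter]
      apply Finset.filter_congr
      intro y _
      simp only [List.mem_cons, forall_eq_or_imp, and_comm]
    have split := Finset.card_filter_add_card_filter_not (s := u) (fun y => R c y)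
    have split' : ((u.filter fun y => R c y).card : ℝ) + (u.filter fun y => ¬ R c y).card =
        u.card := by exact_mod_cast split
    rw [e, pow_succ]
    calc ((u.filter fun y => ¬ R c y).card : ℝ) ≤ (1 - f) * u.card := by linarith
      _ ≤ (1 - f) * ((1 - f) ^ M * s.card) :=
          mul_le_mul_of_nonneg_left hc (by linarith)
      _ = _ := by ring

/-- A complete cover of moderate size. -/
theorem exists_full_cover {C Y : Type} [Fintype C] [DecidableEq Y] (R : C → Y → Prop)
    [∀ c y, Decidable (R c y)] [Nonempty C] (f : ℝ) (s : Finset Y) (hs0 : s.Nonempty)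
    (hs : ∀ y ∈ s, f * Fintype.card C ≤ (Finset.univ.filter fun c => R c y).card)
    (hf : f ≤ 1) (hf0 : 0 < f) :
    ∃ l : List C, (l.length : ℝ) * f ≤ Real.log s.card + 1 ∧ ∀ y ∈ s, ∃ c ∈ l, R c y := by
  have hcard : (0 : ℝ) < s.card := by exact_mod_cast hs0.card_pos
  have hlog : 0 ≤ Real.log s.card := Real.log_natCast_nonneg _
  -- With this many codewords fewer than one point remains uncovered, hence none.
  set M := ⌊Real.log s.card / f⌋₊ + 1 with hM
  obtain ⟨l, hl, hc⟩ := exists_cover R f s hs M hf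
  refine ⟨l, ?_, ?_⟩
  · have h := Nat.floor_le (div_nonneg hlog hf0.le)
    rw [hl, hM]
    push_cast
    have := mul_le_mul_of_nonneg_right h hf0.le
    rw [div_mul_cancel₀ _ hf0.ne'] at this
    linarith
  · have hlt : (1 - f) ^ M * s.card < 1 := by
      have h₁ : Real.log s.card < f * M := by
        have := Nat.lt_floor_add_one (Real.log s.card / f)
        rw [div_lt_iff₀ hf0] at this
        rw [hM]; push_cast; linarith
      calc (1 - f) ^ M * s.card ≤ Real.exp (-f) ^ M * s.card := by
            refine mul_le_mul_of_nonneg_right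
              (pow_le_pow_left₀ (by linarith) ?_ M) hcard.le
            exact Real.one_sub_le_exp_neg f
        _ = Real.exp (-(f * M)) * s.card := by rw [← Real.exp_nat_mul, mul_neg, mul_comm f]
        _ < Real.exp (-Real.log s.card) * s.card := by gcongr
        _ = 1 := by rw [Real.exp_neg, Real.exp_log hcard, inv_mul_cancel₀ hcard.ne']
    have hz : (s.filter fun y => ∀ c ∈ l, ¬ R c y).card = 0 := by
      have : ((s.filter fun y => ∀ c ∈ l, ¬ R c y).card : ℝ) < 1 := hc.trans_lt hlt
      exact Nat.lt_one_iff.1 (by exact_mod_cast this)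
    rw [Finset.card_eq_zero, Finset.filter_eq_empty_iff] at hz
    intro y hy
    have := hz hy
    push Not at this
    exact this

/-! ### Gains of the representatives and the covering table -/

/-- The growth rate of the search in terms of its budget. -/
noncomputable abbrev rate : ℝ := 159 / 100

/-- Three more than the decrease of the weight when a clause is opened with the representative `j`
and the set `S` of its variables has to be flipped. -/
def gain (j : Fin 3) (S : Fin 3 → Bool) : ℕ :=
  2 * count3 S + 3 - openCost (S j) (S (j + 1)) (S (j + 2))

/-- The offset 3 ensures that the subtraction in `gain` never truncates. -/
theorem gain_add (j : Fin 3) (S : Fin 3 → Bool) :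
    gain j S + openCost (S j) (S (j + 1)) (S (j + 2)) = 2 * count3 S + 3 := by
  revert j S; decide

theorem gain_le (j : Fin 3) (S : Fin 3 → Bool) : gain j S ≤ 5 := by
  revert j S; decide

theorem gain_all (j : Fin 3) : gain j (fun _ => true) = 4 := by
  revert j; decide

/-- A representative outside `S` has gain 0; one inside has gain 5 if `S` is a singleton and 4
otherwise. The singleton is the tight case: `rate ^ 5 + 2` barely exceeds `3.02 * rate ^ 3`. What
matters is that 3.02 is greater than 3, the number of representatives. -/
theorem sum_rate_pow_gain (S : Fin 3 → Bool) (hS : ∃ j, S j = true) :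
    (302 / 100 : ℝ) * rate ^ 3 ≤ ∑ j, rate ^ gain j S := by
  -- As multisets the gains depend on the size of `S` only, which leaves three cases.
  have h : (∃ a b c, ({gain 0 S, gain 1 S, gain 2 S} : Multiset ℕ) = {a, b, c} ∧
      ((a = 5 ∧ b = 0 ∧ c = 0) ∨ (a = 4 ∧ b = 4))) := by
    have : ({gain 0 S, gain 1 S, gain 2 S} : Multiset ℕ) = {5, 0, 0} ∨
        ({gain 0 S, gain 1 S, gain 2 S} : Multiset ℕ) = {4, 4, 0} ∨
        ({gain 0 S, gain 1 S, gain 2 S} : Multiset ℕ) = {4, 4, 4} := by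
      revert S; decide
    rcases this with h | h | h <;> exact ⟨_, _, _, h, by simp⟩
  obtain ⟨a, b, c, he, h⟩ := h
  have hsum : ∑ j, rate ^ gain j S = rate ^ a + (rate ^ b + rate ^ c) := by
    have := congrArg (fun m : Multiset ℕ => (m.map fun k => rate ^ k).sum) he
    simp only [Multiset.insert_eq_cons, Multiset.map_cons, Multiset.map_singleton,
      Multiset.sum_cons, Multiset.sum_singleton] at this
    rw [Fin.sum_univ_three, add_assoc]
    exact this
  rw [hsum]
  have hc : 0 < rate ^ c := pow_pos (by norm_num) c
  rcases h with ⟨rfl, rfl, rfl⟩ | ⟨rfl, rfl⟩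
  · norm_num
  · calc (302 / 100 : ℝ) * rate ^ 3 ≤ rate ^ 4 + rate ^ 4 := by norm_num
      _ ≤ _ := by linarith

/-- The total gain of a codeword. -/
def totalGain {K : ℕ} (c : Fin K → Fin 3) (S : Fin K → Fin 3 → Bool) : ℕ := ∑ i, gain (c i) (S i)

theorem totalGain_le {K : ℕ} (c : Fin K → Fin 3) (S : Fin K → Fin 3 → Bool) :
    totalGain c S ≤ 5 * K := by
  calc totalGain c S ≤ ∑ _i : Fin K, 5 := Finset.sum_le_sum fun i _ => gain_le _ _
    _ = 5 * K := by simp [mul_comm]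

/-- The gain is additive over the clauses, so the sum over all codewords factors into the sums for
single clauses. -/
theorem sum_rate_pow_totalGain {K : ℕ} (S : Fin K → Fin 3 → Bool) (hS : ∀ i, ∃ j, S i j = true) :
    ((302 / 100 : ℝ) * rate ^ 3) ^ K ≤ ∑ c : Fin K → Fin 3, rate ^ totalGain c S := by
  have e : ∑ c : Fin K → Fin 3, rate ^ totalGain c S = ∏ i, ∑ j, rate ^ gain j (S i) := by
    rw [Finset.prod_univ_sum, Fintype.piFinset_univ]
    simp only [totalGain, Finset.prod_pow_eq_pow_sum]
  rw [e]
  calc ((302 / 100 : ℝ) * rate ^ 3) ^ K = ∏ _i : Fin K, ((302 / 100 : ℝ) * rate ^ 3) := by simp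
    _ ≤ _ := Finset.prod_le_prod (fun _ _ => by unfold rate; positivity)
        fun i _ => sum_rate_pow_gain _ (hS i)

/-- Some level of the gain is reached by many codewords. -/
theorem exists_level {K : ℕ} (S : Fin K → Fin 3 → Bool) (hS : ∀ i, ∃ j, S i j = true) :
    ∃ g ≤ 5 * K, ((302 / 100 : ℝ) * rate ^ 3) ^ K ≤ (5 * K + 1) * (rate ^ g *
      ((Finset.univ.filter fun c : Fin K → Fin 3 => g ≤ totalGain c S).card : ℝ)) := by
  have h := sum_rate_pow_totalGain S hS
  rw [← Finset.sum_fiberwise_of_maps_to (t := Finset.range (5 * K + 1))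
    (g := fun c => totalGain c S)
    (fun c _ => Finset.mem_range.2 (Nat.lt_succ_of_le (totalGain_le c S)))] at h
  obtain ⟨g, hg, hle⟩ := Finset.exists_le_of_sum_le (s := Finset.range (5 * K + 1))
    (f := fun _ => ((302 / 100 : ℝ) * rate ^ 3) ^ K / (5 * K + 1))
    (g := fun g => ∑ c : Fin K → Fin 3 with totalGain c S = g, rate ^ totalGain c S) ⟨0, by simp⟩ (by
      rw [Finset.sum_const, Finset.card_range, nsmul_eq_mul]
      push_cast
      rw [mul_div_cancel₀ _ (by positivity)]
      exact h)
  refine ⟨g, Nat.lt_succ_iff.1 (Finset.mem_range.1 hg), ?_⟩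
  have hle := (div_le_iff₀ (by positivity)).1 hle
  rw [mul_comm _ (5 * K + 1 : ℝ)] at hle
  refine hle.trans (mul_le_mul_of_nonneg_left ?_ (by positivity))
  -- On the level `g` all terms equal `rate ^ g`, and the level is contained in the set of codewords
  -- of gain at least `g`.
  rw [Finset.sum_congr rfl (g := fun _ => rate ^ g) (by
    intro c hc
    rw [(Finset.mem_filter.1 hc).2]), Finset.sum_const, nsmul_eq_mul, mul_comm]
  gcongr
  exact fun h => h.ge

/-- The left side is the total loss in the Kraft sum: `8 * K * (5 * K + 1)` on each of `5 * K + 1`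
levels. The exponential advantage outgrows it. -/
theorem exists_large_block : ∃ K : ℕ, 0 < K ∧
    (8 * K : ℝ) * (5 * K + 1) ^ 2 ≤ (302 / 300 : ℝ) ^ K / 2 := by
  -- Since `5 * K + 1 ≤ 6 * K`, the left side is at most `288 * K ^ 3`, and `576 = 2 * 288`.
  have h := tendsto_pow_const_mul_const_pow_of_abs_lt_one 3 (r := (300 / 302 : ℝ))
    (by rw [abs_of_pos] <;> norm_num)
  obtain ⟨K, hK, hpos⟩ := ((h.eventually (gt_mem_nhds (show (0 : ℝ) < 1 / 576 by norm_num))).and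
    (Filter.eventually_gt_atTop 0)).exists
  refine ⟨K, hpos, ?_⟩
  have hK1 : (1 : ℝ) ≤ K := by exact_mod_cast hpos
  have hl : (0 : ℝ) < (302 / 300) ^ K := by positivity
  have e : ((300 / 302 : ℝ)) ^ K * (302 / 300) ^ K = 1 := by rw [← mul_pow]; norm_num
  have h₁ : (K : ℝ) ^ 3 < 1 / 576 * (302 / 300) ^ K := by
    calc (K : ℝ) ^ 3 = K ^ 3 * (300 / 302) ^ K * (302 / 300) ^ K := by rw [mul_assoc, e, mul_one]
      _ < _ := by gcongr
  have h₂ : ((5 * K + 1 : ℝ)) ^ 2 ≤ (6 * K) ^ 2 := by gcongr; linarith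
  calc (8 * K : ℝ) * (5 * K + 1 : ℝ) ^ 2 ≤ 8 * K * (6 * K : ℝ) ^ 2 := by gcongr
    _ = 288 * (K : ℝ) ^ 3 := by ring
    _ ≤ _ := by linarith

/-- There is a code that covers every target, and whose costs satisfy a Kraft inequality. -/
theorem exists_code : ∃ (K : ℕ) (table : List ((Fin K → Fin 3) × ℕ)), 0 < K ∧
    (table.map fun x => (rate ^ x.2)⁻¹).sum ≤ 1 / 2 ∧
    ∀ S : Fin K → Fin 3 → Bool, (∀ i, ∃ j, S i j = true) →
      ∃ x ∈ table, x.2 + 3 * K ≤ totalGain x.1 S := by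
  classical
  obtain ⟨K, hK, hbig⟩ := exists_large_block
  have hK1 : (1 : ℝ) ≤ K := by exact_mod_cast hK
  have hrate : (0 : ℝ) < rate := by norm_num
  set lam : ℝ := (302 / 300 : ℝ) ^ K with hlam
  have hlampos : 0 < lam := by positivity
  -- The fraction of codewords that `exists_level` guarantees at level `g`, after division by the
  -- number `3 ^ K` of all codewords.
  let f : ℕ → ℝ := fun g => lam * rate ^ (3 * K) / ((5 * K + 1) * rate ^ g)
  have hf0 : ∀ g, 0 < f g := fun g => by positivity
  let targets : ℕ → Finset (Fin K → Fin 3 → Bool) := fun g => Finset.univ.filter fun S =>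
    f g * Fintype.card (Fin K → Fin 3) ≤
      ((Finset.univ.filter fun c : Fin K → Fin 3 => g ≤ totalGain c S).card : ℝ)
  have hcardC : (Fintype.card (Fin K → Fin 3) : ℝ) = 3 ^ K := by simp
  have step : ∀ g, ∃ l : List (Fin K → Fin 3),
      ((targets g).Nonempty → 3 * K ≤ g) ∧
      (l.map fun _ => (rate ^ (g - 3 * K))⁻¹).sum ≤ 8 * K * (5 * K + 1) / lam ∧
      ∀ S ∈ targets g, ∃ c ∈ l, g ≤ totalGain c S := by
    intro g
    by_cases hne : (targets g).Nonempty
    · obtain ⟨S₀, hS₀⟩ := hne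
      have hf1 : f g ≤ 1 := by
        have h := (Finset.mem_filter.1 hS₀).2
        have h' : ((Finset.univ.filter fun c : Fin K → Fin 3 => g ≤ totalGain c S₀).card : ℝ) ≤
            Fintype.card (Fin K → Fin 3) := by exact_mod_cast Finset.card_le_univ _
        have hpos : (0 : ℝ) < Fintype.card (Fin K → Fin 3) := by rw [hcardC]; positivity
        exact le_of_mul_le_mul_right (by linarith) hpos
      -- The price `g - 3 * K` is a true difference: at a lower level the fraction `f g` would
      -- exceed 1, because `lam` is larger than `5 * K + 1`.
      have hg : 3 * K ≤ g := by
        by_contra hlt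
        push Not at hlt
        have h₁ : lam * rate ^ (3 * K) ≤ (5 * K + 1) * rate ^ g := by
          have := hf1
          rwa [div_le_one (by positivity)] at this
        have h₂ : rate ^ g ≤ rate ^ (3 * K) := pow_le_pow_right₀ (by norm_num) hlt.le
        have h₃ : (5 * K + 1 : ℝ) < lam := by nlinarith
        have h₄ : 0 < rate ^ g := by positivity
        nlinarith
      obtain ⟨l, hl, hcov⟩ := exists_full_cover (fun (c : Fin K → Fin 3) S => g ≤ totalGain c S)
        (f g) (targets g) ⟨S₀, hS₀⟩ (fun S hS => (Finset.mem_filter.1 hS).2) hf1 (hf0 g)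
      refine ⟨l, fun _ => hg, ?_, hcov⟩
      -- There are at most `8 ^ K` targets, and `log 8 ≤ 8 - 1`.
      have hcard : Real.log (targets g).card ≤ 7 * K := by
        have h8 : ((targets g).card : ℝ) ≤ 8 ^ K := by
          have : (targets g).card ≤ 8 ^ K := by
            refine (Finset.card_le_univ _).trans ?_
            simp
          exact_mod_cast this
        have hp : (0 : ℝ) < (targets g).card := by
          exact_mod_cast Finset.card_pos.2 ⟨S₀, hS₀⟩
        calc Real.log (targets g).card ≤ Real.log (8 ^ K) := Real.log_le_log hp h8
          _ = K * Real.log 8 := Real.log_pow _ _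
          _ ≤ K * 7 := by
            gcongr
            have := Real.log_le_sub_one_of_pos (show (0 : ℝ) < 8 by norm_num)
            linarith
          _ = _ := mul_comm _ _
      have hl8 : (l.length : ℝ) * f g ≤ 8 * K := by linarith
      simp only [List.map_const', List.sum_replicate, nsmul_eq_mul]
      -- The fraction `f g` cancels against the length of the code, so each level contributes the
      -- same bound.
      have e : (rate ^ (g - 3 * K))⁻¹ = f g * ((5 * K + 1) / lam) := by
        have : rate ^ g = rate ^ (g - 3 * K) * rate ^ (3 * K) := by
          rw [← pow_add, Nat.sub_add_cancel hg]
        simp only [f]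
        rw [this]
        have h1 : rate ^ (g - 3 * K) ≠ 0 := by positivity
        have h2 : rate ^ (3 * K) ≠ 0 := by positivity
        have h3 : (5 * K + 1 : ℝ) ≠ 0 := by positivity
        field_simp
      rw [e, ← mul_assoc, mul_div_assoc]
      gcongr
    · refine ⟨[], fun h => absurd h hne, by simp; positivity, fun S hS => absurd ⟨S, hS⟩ hne⟩
  choose l hl₁ hl₂ hl₃ using step
  let table : List ((Fin K → Fin 3) × ℕ) :=
    (List.range (5 * K + 1)).flatMap fun g => (l g).map fun c => (c, g - 3 * K)
  refine ⟨K, table, hK, ?_, ?_⟩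
  · have e : (table.map fun x => (rate ^ x.2)⁻¹).sum =
        ∑ g ∈ Finset.range (5 * K + 1), ((l g).map fun _ => (rate ^ (g - 3 * K))⁻¹).sum := by
      simp only [table, List.flatMap_def, List.map_flatten, List.map_map, List.sum_flatten,
        Function.comp_def]
      rw [← List.sum_toFinset _ List.nodup_range, List.toFinset_range]
    rw [e]
    calc _ ≤ ∑ _g ∈ Finset.range (5 * K + 1), (8 * K * (5 * K + 1) / lam : ℝ) :=
          Finset.sum_le_sum fun g _ => hl₂ g
      _ = 8 * K * (5 * K + 1) ^ 2 / lam := by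
          rw [Finset.sum_const, Finset.card_range, nsmul_eq_mul]; push_cast; ring
      _ ≤ 1 / 2 := by rw [div_le_iff₀ hlampos]; linarith
  · intro S hS
    obtain ⟨g, hg, hle⟩ := exists_level S hS
    have hmem : S ∈ targets g := by
      refine Finset.mem_filter.2 ⟨Finset.mem_univ _, ?_⟩
      have hpos : (0 : ℝ) < (5 * K + 1) * rate ^ g := by positivity
      have e : f g * Fintype.card (Fin K → Fin 3) =
          ((302 / 100 : ℝ) * rate ^ 3) ^ K / ((5 * K + 1) * rate ^ g) := by
        simp only [f, hcardC, hlam]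
        rw [div_mul_eq_mul_div, mul_pow, ← pow_mul, mul_right_comm, ← mul_pow]
        norm_num
      rw [e, div_le_iff₀ hpos]
      linarith
    obtain ⟨c, hc, hgc⟩ := hl₃ g S hmem
    have h3 := hl₁ g ⟨S, hmem⟩
    refine ⟨(c, g - 3 * K), ?_, by simp only; omega⟩
    simp only [table, List.mem_flatMap, List.mem_range, List.mem_map]
    exact ⟨g, by omega, c, hc, rfl⟩

/-! ### Correctness and running time of the local search -/

section Search

variable {n : ℕ}

/-- The variables in which two assignments differ. -/
def diff (α β : Assignment n) (i : Fin n) : Bool := xor (α i) (β i)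

/-- `β` is a solution of the ball problem for the list `L` of clauses. -/
def Solution (α : Assignment n) (L : List (List (Literal n))) (r : ℕ) (β : Assignment n) : Prop :=
  (∀ c ∈ L, ListSat β c) ∧ hammingDist α β ≤ r

/-- The answer `ans` is right, except that it may be `false` if no solution has property `p`. -/
def Answers (α : Assignment n) (L : List (List (Literal n))) (r : ℕ) (p : Assignment n → Prop)
    (ans : Bool) : Prop :=
  (ans = true → ∃ β, Solution α L r β) ∧ ∀ β, Solution α L r β → p β → ans = true

/-- `β` can be found from the state `σ` with the budget `W`. -/
def Reach (α : Assignment n) (σ : State n) (W : ℕ) (β : Assignment n) : Prop :=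
  Compatible σ (diff α β) ∧ weight σ (diff α β) ≤ W

variable {α : Assignment n} {L : List (List (Literal n))} {r : ℕ} {p q : Assignment n → Prop}

theorem Answers.false (h : ∀ β, Solution α L r β → ¬ p β) : Answers α L r p false :=
  ⟨by simp, fun β hβ hp => absurd hp (h β hβ)⟩

theorem Answers.mono {a : Bool} (h : Answers α L r p a) (hqp : ∀ β, Solution α L r β → q β → p β) :
    Answers α L r q a :=
  ⟨h.1, fun β hβ hq => h.2 β hβ (hqp β hβ hq)⟩

theorem Answers.or {a b : Bool} (ha : Answers α L r p a) (hb : Answers α L r q b) :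
    Answers α L r (fun β => p β ∨ q β) (a || b) := by
  refine ⟨fun h => ?_, fun β hβ h => ?_⟩
  · rcases Bool.or_eq_true_iff.1 h with h | h
    · exact ha.1 h
    · exact hb.1 h
  · rcases h with h | h
    · simp [ha.2 β hβ h]
    · simp [hb.2 β hβ h]

/-- Evaluate `e` if the budget `W` allows to pay `d`. -/
theorem pay_runs {P : Program} {env : List Tree} {e w : Expr} {W d : ℕ} {T : ℝ} {Q : Bool → Prop}
    (hw : w.isPure = true) (hW : w.value env = Tree.ofNat W) (hT : 0 ≤ T)
    (h : d ≤ W → ∃ ans, Runs P env e (Tree.ofBool ans) T ∧ Q ans) (h' : W < d → Q false) :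
    ∃ ans, Runs P env (.cond (Expr.drop (.cons .nil w) d) e .nil) (Tree.ofBool ans)
      (T + w.size + d + 4) ∧ Q ans := by
  have hp : (Expr.drop (.cons .nil w) d).isPure = true :=
    Expr.drop_isPure (by simpa [Expr.isPure] using hw) d
  -- The additional `cons` makes the tested numeral nonzero exactly when `d ≤ W`.
  have hv : (Expr.drop (.cons .nil w) d).value env = Tree.ofNat (W + 1 - d) :=
    Expr.drop_value_ofNat (by simp [Expr.value, hW, Tree.ofNat]) d
  by_cases hd : d ≤ W
  · obtain ⟨ans, hr, hq⟩ := h hd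
    rw [show W + 1 - d = (W - d) + 1 by omega] at hv
    refine ⟨ans, Runs.mono (Runs.condCons (.pure hp hv) hr) ?_, hq⟩
    rw [Expr.drop_size]
    norm_num [Expr.size]; linarith
  · push Not at hd
    rw [show W + 1 - d = 0 by omega] at hv
    refine ⟨false, Runs.mono (Runs.condNil (.pure hp hv) (.pure rfl rfl)) ?_, h' hd⟩
    rw [Expr.drop_size]
    norm_num [Expr.size]; linarith

variable {K : ℕ} {table : List ((ℕ → Fin 3) × ℕ)}

local notation "ℙ" => program K table

/-- The encoding of an instance. -/
abbrev encInstance (α : Assignment n) (L : List (List (Literal n))) (r : ℕ) : Tree :=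
  .cons (encAssignment α) (.cons (encFormula L) (Tree.ofNat r))

theorem child_runs (σ : State n) (p : Fin n) (a : Status n) (q z : Fin n) (W : ℕ) {v : Tree}
    {T : ℝ} (h : Runs ℙ [.cons (encFormula L) (.cons (encInstance α L r)
      (.cons (σ.settle p a q z).enc (Tree.ofNat W)))] scanBody v T) :
    Runs ℙ [.cons (Tree.ofNat p) (.cons a.enc (.cons (Tree.ofNat q) (.cons (Tree.ofNat z)
      (.cons (encInstance α L r) (.cons σ.enc (Tree.ofNat W))))))] childBody v
      (T + 250 * (n + 1)) := by
  have hn : (0 : ℝ) ≤ n := n.cast_nonneg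
  have h₁ := setState_runs (K := K) (table := table) σ z .out
  have h₂ := setState_runs (K := K) (table := table) (Function.update σ z .out) q .yes
  have h₃ := setState_runs (K := K) (table := table)
    (Function.update (Function.update σ z .out) q .yes) p a
  refine Runs.mono (Runs.call rfl (.cons (.pure rfl rfl) (.cons (.pure rfl rfl)
    (.cons (Runs.call rfl (.cons (.pure rfl rfl) (.cons (.pure rfl rfl)
      (Runs.call rfl (.cons (.pure rfl rfl) (.cons (.pure rfl rfl)
        (Runs.call rfl (.pure rfl rfl) h₁))) h₂))) h₃) (.pure rfl rfl)))) h) ?_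
  norm_num [Expr.size, Expr.drop, yesExpr]; linarith

/-! ### The recursion on the budget -/

/-- What the local search does with the budget `W`. -/
def ScanSpec (K : ℕ) (table : List ((ℕ → Fin 3) × ℕ)) (α : Assignment n)
    (L : List (List (Literal n))) (r : ℕ) (C : ℝ) (W : ℕ) : Prop :=
  ∀ σ : State n, Valid α L [] σ → ∃ ans,
    Runs (program K table) [.cons (encFormula L) (.cons (encInstance α L r)
      (.cons σ.enc (Tree.ofNat W)))] scanBody (Tree.ofBool ans) (C * rate ^ W) ∧
    Answers α L r (Reach α σ W) ans

theorem rate_pow_sub {W d : ℕ} (h : d ≤ W) : rate ^ (W - d) = rate ^ W * (rate ^ d)⁻¹ :=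
  pow_sub₀ _ (by norm_num) h

/-- The common form of all branches that settle an open clause. As `d` is positive, the induction
hypothesis applies; if `d` exceeds the budget, the answer `false` is right because the property on
the answer includes `d`. -/
theorem childExpr_runs {C : ℝ} {W d : ℕ} (hC : 0 ≤ C) (hd : 0 < d)
    (ih : ∀ W' < W, ScanSpec K table α L r C W') {σ : State n} {p q z : Fin n} {a : Status n}
    (hv : Valid α L [] (σ.settle p a q z)) {st lt : Tree} {ep ea eq ez : Expr}
    (hp : ep.isPure = true ∧ ep.size ≤ 10) (ha : ea.isPure = true ∧ ea.size ≤ 10)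
    (hq : eq.isPure = true ∧ eq.size ≤ 10) (hz : ez.isPure = true ∧ ez.size ≤ 10)
    (vp : ep.value [st, .cons lt (.cons (encInstance α L r) (.cons σ.enc (Tree.ofNat W)))] =
      Tree.ofNat p)
    (va : ea.value [st, .cons lt (.cons (encInstance α L r) (.cons σ.enc (Tree.ofNat W)))] = a.enc)
    (vq : eq.value [st, .cons lt (.cons (encInstance α L r) (.cons σ.enc (Tree.ofNat W)))] =
      Tree.ofNat q)
    (vz : ez.value [st, .cons lt (.cons (encInstance α L r) (.cons σ.enc (Tree.ofNat W)))] =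
      Tree.ofNat z) :
    ∃ ans, Runs ℙ [st, .cons lt (.cons (encInstance α L r) (.cons σ.enc (Tree.ofNat W)))]
      (childExpr d ep ea eq ez) (Tree.ofBool ans)
      (C * rate ^ W * (rate ^ d)⁻¹ + 350 * (n + 1) + 2 * d) ∧
      Answers α L r (fun β => Compatible (σ.settle p a q z) (diff α β) ∧
        weight (σ.settle p a q z) (diff α β) + d ≤ W) ans := by
  have hn : (0 : ℝ) ≤ n := n.cast_nonneg
  have hd0 : (0 : ℝ) ≤ d := d.cast_nonneg
  have hrate : (0 : ℝ) < rate := by norm_num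
  have key := pay_runs (P := ℙ)
    (env := [st, .cons lt (.cons (encInstance α L r) (.cons σ.enc (Tree.ofNat W)))])
    (w := .tl (.tl (.tl (.var 1)))) (W := W) (d := d)
    (e := .call fChild (.cons ep (.cons ea (.cons eq (.cons ez (.cons (.hd (.tl (.var 1)))
      (.cons (.hd (.tl (.tl (.var 1)))) (Expr.drop (.tl (.tl (.tl (.var 1)))) d))))))))
    (T := C * rate ^ W * (rate ^ d)⁻¹ + 250 * (n + 1) + 80 + d)
    (Q := Answers α L r (fun β => Compatible (σ.settle p a q z) (diff α β) ∧
        weight (σ.settle p a q z) (diff α β) + d ≤ W)) rfl rfl (by positivity)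
    (fun hdW => by
      obtain ⟨ans, hr, hans⟩ := ih (W - d) (by omega) _ hv
      refine ⟨ans, ?_, hans.mono fun β _ h => ⟨h.1, by omega⟩⟩
      have hW : (Expr.drop (.tl (.tl (.tl (.var 1)))) d).value
          [st, .cons lt (.cons (encInstance α L r) (.cons σ.enc (Tree.ofNat W)))] =
          Tree.ofNat (W - d) := Expr.drop_value_ofNat rfl d
      refine Runs.mono (Runs.call rfl (.cons (.pure hp.1 vp) (.cons (.pure ha.1 va)
        (.cons (.pure hq.1 vq) (.cons (.pure hz.1 vz) (.cons (.pure rfl rfl)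
          (.cons (.pure rfl rfl) (.pure (Expr.drop_isPure rfl d) hW)))))))
        (child_runs σ p a q z (W - d) hr)) ?_
      rw [rate_pow_sub hdW, Expr.drop_size]
      have k₁ : (ep.size : ℝ) ≤ 10 := by exact_mod_cast hp.2
      have k₂ : (ea.size : ℝ) ≤ 10 := by exact_mod_cast ha.2
      have k₃ : (eq.size : ℝ) ≤ 10 := by exact_mod_cast hq.2
      have k₄ : (ez.size : ℝ) ≤ 10 := by exact_mod_cast hz.2
      simp only [Expr.size]
      push_cast
      linarith)
    (fun hlt => Answers.false fun β _ h => by omega)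
  obtain ⟨ans, hr, hans⟩ := key
  refine ⟨ans, hr.mono ?_, hans⟩
  norm_num [Expr.size]; linarith

theorem diff_of_pos {β : Assignment n} {l : Literal n} (h : α l.1 = l.2)
    (hβ : Literal.Holds β l) : diff α β l.1 = false := by
  unfold Literal.Holds at hβ
  simp [diff, h, hβ]

theorem diff_of_neg {β : Assignment n} {l : Literal n} (h : ¬ α l.1 = l.2)
    (hβ : Literal.Holds β l) : diff α β l.1 = true := by
  unfold Literal.Holds at hβ
  simp only [diff, hβ, bne_iff_ne, ne_eq, h, not_false_eq_true]

theorem flipped_of_pos {σ : State n} {l : Literal n} (h : α l.1 = l.2)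
    (hs : ¬ Literal.Holds (σ.current α) l) : (σ l.1).flipped = true := by
  unfold Literal.Holds State.current at hs
  rw [h] at hs
  revert hs
  cases l.2 <;> cases (σ l.1).flipped <;> simp

theorem not_flipped_of_neg {σ : State n} {l : Literal n} (h : ¬ α l.1 = l.2)
    (hs : ¬ Literal.Holds (σ.current α) l) : (σ l.1).flipped = false := by
  unfold Literal.Holds State.current at hs
  revert h hs
  cases α l.1 <;> cases l.2 <;> cases (σ l.1).flipped <;> simp

/-- The share of the running time that goes into a literal. -/
noncomputable def share (α : Assignment n) (l : Literal n) : ℝ :=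
  if α l.1 = l.2 then 2 * (rate ^ 5)⁻¹ else (rate ^ 2)⁻¹

/-- A literal true under `α` but false at present has a flipped variable: a decided one cannot be
taken back, and a withdrawn core forces one of its two sides. A literal false under `α` has an
unflipped variable: it is excluded, or `out`, or a side whose core is then withdrawn or confirmed.
The last case fits into the share of an `out` variable because `rate ^ (-5) + rate ^ (-3) ≤ rate ^
(-2)`. -/
theorem attempt_runs {C : ℝ} {W : ℕ} (hC : 0 ≤ C) (ih : ∀ W' < W, ScanSpec K table α L r C W')
    {σ : State n} (hv : Valid α L [] σ) (l : Literal n)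
    (hl : ¬ Literal.Holds (σ.current α) l) :
    ∃ ans, Runs ℙ [.cons (Tree.ofLiteral l) (.cons (encInstance α L r)
        (.cons σ.enc (Tree.ofNat W)))] attemptBody (Tree.ofBool ans)
        (share α l * (C * rate ^ W) + 1000 * (n + 1)) ∧
      Answers α L r (fun β => Reach α σ W β ∧ Literal.Holds β l) ans := by
  have hn : (0 : ℝ) ≤ n := n.cast_nonneg
  have hrate : (0 : ℝ) < rate := by norm_num
  set T : ℝ := C * rate ^ W with hT
  have hT0 : 0 ≤ T := by positivity
  have hp := pos_runs (K := K) (table := table) α l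
  have hg := getFin_runs (K := K) (table := table) Status.enc σ l.1
  by_cases h : α l.1 = l.2
  · rw [decide_eq_true h] at hp
    have hf := flipped_of_pos h hl
    have hs : share α l = 2 * (rate ^ 5)⁻¹ := if_pos h
    suffices hsuff : ∃ ans, Runs ℙ [(σ l.1).enc, .cons (Tree.ofLiteral l)
        (.cons (encInstance α L r) (.cons σ.enc (Tree.ofNat W)))] attemptPos (Tree.ofBool ans)
        (share α l * T + 800 * (n + 1)) ∧
        Answers α L r (fun β => Reach α σ W β ∧ Literal.Holds β l) ans by
      obtain ⟨ans, hr, hans⟩ := hsuff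
      refine ⟨ans, Runs.mono (Runs.condCons (Runs.call rfl (.pure rfl rfl) hp)
        (Runs.bind (Runs.call rfl (.pure rfl rfl) hg) hr)) ?_, hans⟩
      norm_num [Expr.size]; linarith
    cases hst : σ l.1 with
    | out | no | side => simp [hst, Status.flipped] at hf
    | yes =>
      refine ⟨false, Runs.mono (Runs.condNil (.pure rfl rfl) (.pure rfl rfl)) ?_,
        Answers.false fun β _ hβ => ?_⟩
      · have : 0 ≤ share α l * T := by rw [hs]; positivity
        norm_num [Expr.size]; linarith
      · have := (hβ.1.1 l.1).1 hst
        rw [diff_of_pos h hβ.2] at this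
        exact Bool.noConfusion this
    | core y z =>
      obtain ⟨a₁, r₁, k₁⟩ := childExpr_runs (d := 5) (a := .no) hC (by norm_num) ih
        (hv.settle (.inl hst) (.inl rfl)) (st := (σ l.1).enc) (lt := Tree.ofLiteral l)
        (ep := .hd (.hd (.var 1))) (ea := noExpr) (eq := .hd (.tl (.var 0)))
        (ez := .tl (.tl (.var 0))) (by decide) (by decide) (by decide) (by decide) rfl rfl
        (by rw [hst]; rfl) (by rw [hst]; rfl)
      obtain ⟨a₂, r₂, k₂⟩ := childExpr_runs (d := 5) (a := .no) hC (by norm_num) ih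
        (hv.settle (.inr hst) (.inl rfl)) (st := (σ l.1).enc) (lt := Tree.ofLiteral l)
        (ep := .hd (.hd (.var 1))) (ea := noExpr) (eq := .tl (.tl (.var 0)))
        (ez := .hd (.tl (.var 0))) (by decide) (by decide) (by decide) (by decide) rfl rfl
        (by rw [hst]; rfl) (by rw [hst]; rfl)
      rw [hst] at r₁ r₂
      refine ⟨a₁ || a₂, Runs.mono (Runs.condCons (.pure rfl rfl) (Runs.or r₁ r₂ ?_)) ?_,
        (k₁.or k₂).mono fun β _ hβ => ?_⟩
      · positivity
      · rw [hs, ← hT]; norm_num [Expr.size]; linarith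
      · have hX := diff_of_pos h hβ.2
        have hc := (hβ.1.1 l.1).2.2 y z hst
        rw [hX] at hc
        rcases hc with hc | hc | hc
        · exact Bool.noConfusion hc
        · obtain ⟨m₁, m₂⟩ := hv.settle_spec (.inl hst) hβ.1.1 hc (.inl ⟨rfl, hX, rfl⟩)
          exact .inl ⟨m₁, m₂.trans_le hβ.1.2⟩
        · obtain ⟨m₁, m₂⟩ := hv.settle_spec (.inr hst) hβ.1.1 hc (.inl ⟨rfl, hX, rfl⟩)
          exact .inr ⟨m₁, m₂.trans_le hβ.1.2⟩
  · rw [decide_eq_false h] at hp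
    have hf := not_flipped_of_neg h hl
    have hs : share α l = (rate ^ 2)⁻¹ := if_neg h
    suffices hsuff : ∃ ans, Runs ℙ [(σ l.1).enc, .cons (Tree.ofLiteral l)
        (.cons (encInstance α L r) (.cons σ.enc (Tree.ofNat W)))] attemptNeg (Tree.ofBool ans)
        (share α l * T + 800 * (n + 1)) ∧
        Answers α L r (fun β => Reach α σ W β ∧ Literal.Holds β l) ans by
      obtain ⟨ans, hr, hans⟩ := hsuff
      refine ⟨ans, Runs.mono (Runs.condNil (Runs.call rfl (.pure rfl rfl) hp)
        (Runs.bind (Runs.call rfl (.pure rfl rfl) hg) hr)) ?_, hans⟩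
      norm_num [Expr.size]; linarith
    cases hst : σ l.1 with
    | yes | core => simp [hst, Status.flipped] at hf
    | no =>
      refine ⟨false, Runs.mono (Runs.condCons (.pure rfl rfl) (Runs.condNil (.pure rfl rfl)
        (.pure rfl rfl))) ?_, Answers.false fun β _ hβ => ?_⟩
      · have : 0 ≤ share α l * T := by rw [hs]; positivity
        norm_num [Expr.size]; linarith
      · have := (hβ.1.1 l.1).2.1 hst
        rw [diff_of_neg h hβ.2] at this
        exact Bool.noConfusion this
    | out =>
      obtain ⟨ans, hr, hans⟩ := pay_runs (P := ℙ)
        (env := [(.out : Status n).enc, .cons (Tree.ofLiteral l)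
          (.cons (encInstance α L r) (.cons σ.enc (Tree.ofNat W)))])
        (w := .tl (.tl (.tl (.var 1)))) (W := W) (d := 2)
        (e := .call fScan (.cons (.hd (.tl (.hd (.tl (.var 1))))) (.cons (.hd (.tl (.var 1)))
          (.cons (.call fSet (.cons (.hd (.hd (.var 1)))
            (.cons yesExpr (.hd (.tl (.tl (.var 1)))))))
            (Expr.drop (.tl (.tl (.tl (.var 1)))) 2)))))
        (T := T * (rate ^ 2)⁻¹ + 100 * (n + 1))
        (Q := Answers α L r (fun β => Reach α σ W β ∧ Literal.Holds β l)) rfl rfl (by positivity)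
        (fun hdW => by
          obtain ⟨ans, hr, hans⟩ := ih (W - 2) (by omega) _ (hv.update_yes hst)
          refine ⟨ans, ?_, hans.mono fun β _ hβ => ?_⟩
          · have hW : (Expr.drop (.tl (.tl (.tl (.var 1)))) 2).value
                [(.out : Status n).enc, .cons (Tree.ofLiteral l)
                  (.cons (encInstance α L r) (.cons σ.enc (Tree.ofNat W)))] =
                Tree.ofNat (W - 2) := Expr.drop_value_ofNat rfl 2
            refine Runs.mono (Runs.call rfl (.cons (.pure rfl rfl) (.cons (.pure rfl rfl)
              (.cons (Runs.call rfl (.pure rfl rfl)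
                (setState_runs (K := K) (table := table) σ l.1 .yes))
                (.pure (Expr.drop_isPure rfl 2) hW)))) hr) ?_
            rw [rate_pow_sub hdW, ← mul_assoc, ← hT]
            norm_num [Expr.size, Expr.drop, yesExpr]; linarith
          · obtain ⟨m₁, m₂⟩ := update_yes_spec hst hβ.1.1 (diff_of_neg h hβ.2)
            exact ⟨m₁, by have := hβ.1.2; omega⟩)
        (fun hlt => Answers.false fun β _ hβ => by
          obtain ⟨m₁, m₂⟩ := update_yes_spec hst hβ.1.1 (diff_of_neg h hβ.2)
          have := hβ.1.2
          omega)
      refine ⟨ans, Runs.mono (Runs.condNil (.pure rfl rfl) hr) ?_, hans⟩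
      rw [hs]; norm_num [Expr.size]; linarith
    | side x z =>
      have hx : σ x = .core l.1 z ∨ σ x = .core z l.1 := hv.side _ _ _ hst
      obtain ⟨a₁, r₁, k₁⟩ := childExpr_runs (d := 5) (a := .no) hC (by norm_num) ih
        (hv.settle hx (.inl rfl)) (st := (σ l.1).enc) (lt := Tree.ofLiteral l)
        (ep := .hd (.tl (.var 0))) (ea := noExpr) (eq := .hd (.hd (.var 1)))
        (ez := .tl (.tl (.var 0))) (by decide) (by decide) (by decide) (by decide)
        (by rw [hst]; rfl) rfl rfl (by rw [hst]; rfl)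
      obtain ⟨a₂, r₂, k₂⟩ := childExpr_runs (d := 3) (a := .yes) hC (by norm_num) ih
        (hv.settle hx (.inr rfl)) (st := (σ l.1).enc) (lt := Tree.ofLiteral l)
        (ep := .hd (.tl (.var 0))) (ea := yesExpr) (eq := .hd (.hd (.var 1)))
        (ez := .tl (.tl (.var 0))) (by decide) (by decide) (by decide) (by decide)
        (by rw [hst]; rfl) rfl rfl (by rw [hst]; rfl)
      rw [hst] at r₁ r₂
      refine ⟨a₁ || a₂, Runs.mono (Runs.condCons (.pure rfl rfl) (Runs.condCons (.pure rfl rfl)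
        (Runs.or r₁ r₂ ?_))) ?_, (k₁.or k₂).mono fun β _ hβ => ?_⟩
      · positivity
      · have hnum : (rate ^ 5)⁻¹ + (rate ^ 3)⁻¹ ≤ (rate ^ 2)⁻¹ := by norm_num
        have := mul_le_mul_of_nonneg_left hnum hT0
        rw [hs, ← hT]; norm_num [Expr.size] at this ⊢; linarith
      · have hX := diff_of_neg h hβ.2
        cases hxX : diff α β x
        · obtain ⟨m₁, m₂⟩ := hv.settle_spec hx hβ.1.1 hX (.inl ⟨rfl, hxX, rfl⟩)
          exact .inl ⟨m₁, m₂.trans_le hβ.1.2⟩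
        · obtain ⟨m₁, m₂⟩ := hv.settle_spec hx hβ.1.1 hX (.inr ⟨rfl, hxX, rfl⟩)
          exact .inr ⟨m₁, m₂.trans_le hβ.1.2⟩

theorem share_nonneg (α : Assignment n) (l : Literal n) : 0 ≤ share α l := by
  unfold share; split_ifs <;> norm_num

/-- A literal true under `α` saves at least 0.1987 compared with the bound 0.3956 for any other; the
saving is counted once. For at most three literals, one of them true under `α`, the total is at most
0.9881. -/
theorem sum_share_le (α : Assignment n) (c : List (Literal n)) :
    (c.map (share α)).sum ≤ 0.3956 * c.length - if ListSat α c then 0.1987 else 0 := by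
  induction c with
  | nil => simp [ListSat]
  | cons l c ih =>
    simp only [List.map_cons, List.sum_cons, List.length_cons, Nat.cast_add, Nat.cast_one]
    have h₂ : (rate ^ 2)⁻¹ ≤ 0.3956 := by norm_num
    have h₅ : 2 * (rate ^ 5)⁻¹ ≤ (0.3956 - 0.1987 : ℝ) := by norm_num
    have hpos : (0 : ℝ) ≤ if ListSat α c then 0.1987 else 0 := by split_ifs <;> norm_num
    by_cases hl : α l.1 = l.2
    · have hs : share α l = 2 * (rate ^ 5)⁻¹ := if_pos hl
      rw [if_pos ⟨l, by simp, hl⟩]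
      linarith
    · have hs : share α l = (rate ^ 2)⁻¹ := if_neg hl
      have e : ListSat α (l :: c) ↔ ListSat α c := by simp [ListSat, Literal.Holds, hl]
      simp only [e]
      linarith

theorem branch_runs {C : ℝ} {W : ℕ} (hC : 0 ≤ C) (ih : ∀ W' < W, ScanSpec K table α L r C W')
    {σ : State n} (hv : Valid α L [] σ) (c : List (Literal n))
    (hc : ¬ ListSat (σ.current α) c) :
    ∃ ans, Runs ℙ [.cons (encClause c) (.cons (encInstance α L r)
        (.cons σ.enc (Tree.ofNat W)))] branchBody (Tree.ofBool ans)
        ((c.map (share α)).sum * (C * rate ^ W) + 1100 * (n + 1) * (c.length + 1)) ∧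
      Answers α L r (fun β => Reach α σ W β ∧ ListSat β c) ans := by
  have hn : (0 : ℝ) ≤ n := n.cast_nonneg
  have hrate : (0 : ℝ) < rate := by norm_num
  induction c with
  | nil =>
    refine ⟨false, Runs.mono (Runs.condNil (.pure rfl rfl) (.pure rfl rfl)) ?_,
      Answers.false fun β _ hβ => by simp [ListSat] at hβ⟩
    norm_num [Expr.size]; linarith
  | cons l c ihc =>
    obtain ⟨a₁, r₁, k₁⟩ := attempt_runs hC ih hv l fun h => hc ⟨l, by simp, h⟩
    obtain ⟨a₂, r₂, k₂⟩ := ihc fun ⟨l', hl', h⟩ => hc ⟨l', by simp [hl'], h⟩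
    have hsum : 0 ≤ (c.map (share α)).sum :=
      List.sum_nonneg (by simp only [List.mem_map]; rintro _ ⟨l, _, rfl⟩; exact share_nonneg _ _)
    refine ⟨a₁ || a₂, Runs.mono (Runs.condCons (.pure rfl rfl) (Runs.or
      (Runs.call rfl (.pure rfl rfl) r₁) (Runs.call rfl (.pure rfl rfl) r₂) ?_)) ?_,
      (k₁.or k₂).mono fun β _ hβ => ?_⟩
    · positivity
    · simp only [List.map_cons, List.sum_cons, List.length_cons]
      norm_num [Expr.size]; nlinarith
    · obtain ⟨hR, l', hl', h⟩ := hβ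
      rcases List.mem_cons.1 hl' with rfl | hl'
      · exact .inl ⟨hR, h⟩
      · exact .inr ⟨hR, l', hl', h⟩

theorem card_diff (α β : Assignment n) :
    (Finset.univ.filter fun i => diff α β i = true).card = hammingDist α β := by
  unfold hammingDist diff
  simp

/-- Passing over a true clause spends no budget, so this is an induction on the clauses left to
check, inside the one on `W`. At the end of the list the present assignment satisfies all of `L`. -/
theorem scan_list_runs {C : ℝ} {W : ℕ} (hC : 0 ≤ C) (ih : ∀ W' < W, ScanSpec K table α L r C W')
    (hL : ∀ c ∈ L, c.length ≤ 3) {σ : State n} (hv : Valid α L [] σ) (L' : List (List (Literal n)))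
    (hsub : ∀ c ∈ L', c ∈ L) (hsat : ∀ c ∈ L, c ∉ L' → ListSat (σ.current α) c) :
    ∃ ans, Runs ℙ [.cons (encFormula L') (.cons (encInstance α L r)
        (.cons σ.enc (Tree.ofNat W)))] scanBody (Tree.ofBool ans)
        (0.9881 * (C * rate ^ W) + 6000 * (n + 1) * (L'.length + 1)) ∧
      Answers α L r (Reach α σ W) ans := by
  have hn : (0 : ℝ) ≤ n := n.cast_nonneg
  have hrate : (0 : ℝ) < rate := by norm_num
  have hT0 : 0 ≤ C * rate ^ W := by positivity
  induction L' with
  | nil =>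
    have hw := within_runs (K := K) (table := table) (List.ofFn σ) r
    rw [List.length_ofFn] at hw
    refine ⟨_, Runs.mono (Runs.condNil (.pure rfl rfl) (Runs.call rfl (.pure rfl rfl) hw)) ?_,
      fun h => ⟨σ.current α, fun c hc => hsat c hc (by simp), ?_⟩, fun β hβ hR => ?_⟩
    · norm_num [Expr.size]; linarith
    · rw [hammingDist_current]; exact of_decide_eq_true h
    · refine decide_eq_true ((hv.countP_le hR.1).trans ?_)
      rw [card_diff]
      exact hβ.2
  | cons c L' ihL =>
    have hcs := csat_runs (K := K) (table := table) α σ c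
    have hlen : (c.length : ℝ) ≤ 3 := by exact_mod_cast hL c (hsub c (by simp))
    have hb : 150 * ((n : ℝ) + 1) * (c.length + 1) ≤ 600 * (n + 1) := by nlinarith
    have hl0 : (0 : ℝ) ≤ L'.length := Nat.cast_nonneg _
    by_cases hs : ListSat (σ.current α) c
    · rw [decide_eq_true hs] at hcs
      obtain ⟨ans, hr, hans⟩ := ihL (fun c hc => hsub c (by simp [hc])) fun c' hc' hn' => by
        by_cases e : c' = c
        · exact e ▸ hs
        · exact hsat c' hc' (by simp [e, hn'])
      refine ⟨ans, Runs.mono (Runs.condCons (.pure rfl rfl) (Runs.condCons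
        (Runs.call rfl (.pure rfl rfl) hcs) (Runs.call rfl (.pure rfl rfl) hr))) ?_, hans⟩
      simp only [List.length_cons]
      norm_num [Expr.size]; nlinarith
    · rw [decide_eq_false hs] at hcs
      obtain ⟨ans, hr, hans⟩ := branch_runs hC ih hv c hs
      have hpos := hv.exists_pos (hsub c (by simp)) hs
      have hsh := sum_share_le α c
      rw [if_pos hpos] at hsh
      refine ⟨ans, Runs.mono (Runs.condCons (.pure rfl rfl) (Runs.condNil
        (Runs.call rfl (.pure rfl rfl) hcs) (Runs.call rfl (.pure rfl rfl) hr))) ?_,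
        hans.mono fun β hβ hR => ⟨hR, hβ.1 c (hsub c (by simp))⟩⟩
      have h₁ : (c.map (share α)).sum * (C * rate ^ W) ≤ 0.9881 * (C * rate ^ W) :=
        mul_le_mul_of_nonneg_right (by linarith) hT0
      have h₂ : 1100 * ((n : ℝ) + 1) * (c.length + 1) ≤ 4400 * (n + 1) := by nlinarith
      simp only [List.length_cons]
      norm_num [Expr.size] at h₁ h₂ hb ⊢; nlinarith

/-- A bound for the running time of the local search. -/
noncomputable def searchCost (n m : ℕ) : ℝ := 10 ^ 6 * ((n + 1) * (m + 1))

/-- The branches use at most 0.9881 of the allowance; the remaining 0.0119 pays for the polynomial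
overhead, which is why `searchCost` has the factor `10 ^ 6`. -/
theorem scan_runs (hL : ∀ c ∈ L, c.length ≤ 3) (W : ℕ) :
    ScanSpec K table α L r (searchCost n L.length) W := by
  induction W using Nat.strong_induction_on with
  | _ W ih =>
    intro σ hv
    have hC : 0 ≤ searchCost n L.length := by unfold searchCost; positivity
    obtain ⟨ans, hr, hans⟩ := scan_list_runs hC ih hL hv L (fun _ h => h)
      fun c hc hn => absurd hc hn
    refine ⟨ans, hr.mono ?_, hans⟩
    have h1 : (1 : ℝ) ≤ rate ^ W := one_le_pow₀ (by norm_num)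
    have h2 : searchCost n L.length ≤ searchCost n L.length * rate ^ W :=
      le_mul_of_one_le_right hC h1
    have h3 : 6000 * ((n : ℝ) + 1) * (L.length + 1) ≤ 0.0119 * searchCost n L.length := by
      have : (0 : ℝ) ≤ (n + 1) * (L.length + 1) := by positivity
      unfold searchCost
      linarith
    linarith

end Search

/-! ### Choosing the representatives -/

section Expand

variable {n : ℕ}

/-- The state after the first `k` clauses of the list `ls` are opened as `c` says. -/
def codeState (σ : State n) (ls : List (Fin 3 → Literal n)) (c : ℕ → Fin 3) : ℕ → State n
  | 0 => σ
  | i + 1 => match ls[i]? with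
    | some l => (codeState σ ls c i).openAt l (c i)
    | none => codeState σ ls c i

/-- The encoding of a list of clauses with three literals. -/
abbrev encTriples (ls : List (Fin 3 → Literal n)) : Tree :=
  Tree.ofList (fun l => encClause (List.ofFn l)) ls

/-- The positions in the clause number `k` where `X` holds; all positions if there is no such
clause. -/
def target (ls : List (Fin 3 → Literal n)) (X : Fin n → Bool) (k : ℕ) : Fin 3 → Bool :=
  match ls[k]? with
  | some l => fun j => X (l j).1
  | none => fun _ => true

variable {α : Assignment n} {L : List (List (Literal n))} {r : ℕ} {σ : State n}
  {ls : List (Fin 3 → Literal n)} {X : Fin n → Bool} {K : ℕ} {table : List ((ℕ → Fin 3) × ℕ)}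

local notation "ℙ" => program K table

theorem Valid.injective (hL : DisjointTriples α L) (h : Valid α L (ls.map List.ofFn) σ)
    {l : Fin 3 → Literal n} (hl : l ∈ ls) : Function.Injective fun j => (l j).1 := by
  obtain ⟨h₁, h₂, -⟩ := h.mem _ (List.mem_map_of_mem hl)
  obtain ⟨l', he, hinj⟩ := hL.triple _ h₁ h₂
  rwa [List.ofFn_injective he]

theorem codeState_valid (hL : DisjointTriples α L) (h : Valid α L (ls.map List.ofFn) σ)
    (c : ℕ → Fin 3) (i : ℕ) :
    Valid α L ((ls.drop i).map List.ofFn) (codeState σ ls c i) := by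
  induction i with
  | zero => exact h
  | succ i ih =>
    unfold codeState
    by_cases hi : i < ls.length
    · rw [List.getElem?_eq_getElem hi]
      rw [List.drop_eq_getElem_cons hi, List.map_cons] at ih
      exact ih.openAt hL (h.injective hL (List.getElem_mem hi)) (c i)
    · rw [List.getElem?_eq_none (by omega)]
      rw [List.drop_eq_nil_of_le (by omega)] at ih ⊢
      exact ih

/-- The term `3 * i` undoes the offset in `gain`. The truncated `i - ls.length` counts the positions
beyond the end: `target` assigns them gain 4 although they leave the weight unchanged, so each loses
one unit. -/
theorem codeState_spec (hL : DisjointTriples α L) (h : Valid α L (ls.map List.ofFn) σ)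
    (hX : Compatible σ X) (hS : ∀ l ∈ ls, ∃ j, X (l j).1 = true) (c : ℕ → Fin 3) (i : ℕ) :
    Compatible (codeState σ ls c i) X ∧
      weight (codeState σ ls c i) X + ∑ k ∈ Finset.range i, gain (c k) (target ls X k) =
        weight σ X + 3 * i + (i - ls.length) := by
  induction i with
  | zero => exact ⟨hX, by simp [codeState]⟩
  | succ i ih =>
    have hv := codeState_valid hL h c i
    rw [Finset.sum_range_succ]
    unfold codeState target
    by_cases hi : i < ls.length
    · rw [List.getElem?_eq_getElem hi]
      rw [List.drop_eq_getElem_cons hi, List.map_cons] at hv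
      have ho : ∀ j, codeState σ ls c i (ls[i] j).1 = .out := fun j =>
        (hv.mem _ List.mem_cons_self).2.2 _ (hasVar_ofFn j)
      obtain ⟨k₁, k₂⟩ := openAt_spec (h.injective hL (List.getElem_mem hi)) ho ih.1
        (hS _ (List.getElem_mem hi)) (c i)
      refine ⟨k₁, ?_⟩
      have hg := gain_add (c i) fun j => X (ls[i] j).1
      have := ih.2
      unfold target at this
      simp only at *
      omega
    · rw [List.getElem?_eq_none (by omega)]
      refine ⟨ih.1, ?_⟩
      have := ih.2
      unfold target at this
      simp only [gain_all]
      omega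

theorem blockLiteral_isPure (i j : ℕ) : (blockLiteral i j).isPure = true :=
  Expr.drop_isPure (e := .hd (Expr.drop (.hd .arg) i))
    (Expr.drop_isPure (e := .hd .arg) rfl i) j

theorem blockLiteral_size (i j : ℕ) : (blockLiteral i j).size = i + j + 4 := by
  simp only [blockLiteral, Expr.size, Expr.drop_size]; ring

theorem blockLiteral_value_some {t : Tree} {i : ℕ} (hi : i < ls.length) (j : Fin 3) :
    (blockLiteral i j).value [.cons (encTriples ls) t] = Tree.ofLiteral (ls[i] j) := by
  have h₁ := Expr.drop_value_ofList (env := [.cons (encTriples ls) t]) (e := .hd .arg)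
    (enc := fun l => encClause (List.ofFn l)) (xs := ls) rfl i
  rw [List.drop_eq_getElem_cons hi] at h₁
  have h₂ := Expr.drop_value_ofList (env := [.cons (encTriples ls) t])
    (e := .hd (Expr.drop (.hd .arg) i)) (enc := Tree.ofLiteral) (xs := List.ofFn ls[i])
    (by simp only [Expr.value, h₁]; rfl) j
  rw [List.drop_eq_getElem_cons (by simp)] at h₂
  simp only [blockLiteral, Expr.value, h₂, List.getElem_ofFn]
  rfl

/-- Beyond the end of the list the value is `nil`, which `open` takes as the sign to leave the state
alone. -/
theorem blockLiteral_value_none {t : Tree} {i : ℕ} (hi : ls.length ≤ i) (j : ℕ) :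
    (blockLiteral i j).value [.cons (encTriples ls) t] = .nil := by
  have h₁ := Expr.drop_value_ofList (env := [.cons (encTriples ls) t]) (e := .hd .arg)
    (enc := fun l => encClause (List.ofFn l)) (xs := ls) rfl i
  rw [List.drop_eq_nil_of_le hi] at h₁
  have h₂ := Expr.drop_value_ofList (env := [.cons (encTriples ls) t])
    (e := .hd (Expr.drop (.hd .arg) i)) (enc := Tree.ofLiteral (n := n)) (xs := [])
    (by simp only [Expr.value, h₁]; rfl) j
  simp only [blockLiteral, Expr.value, h₂, List.drop_nil]
  rfl

theorem codeExpr_runs (σ : State n) (ls : List (Fin 3 → Literal n)) (x w : Tree) (c : ℕ → Fin 3)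
    (i : ℕ) (hi : i ≤ K) :
    Runs ℙ [.cons (encTriples ls) (.cons x (.cons σ.enc w))] (codeExpr c i)
      (codeState σ ls c i).enc (400 * (n + 1) * (K + 1) * (i + 1)) := by
  have hn : (0 : ℝ) ≤ n := n.cast_nonneg
  have hK : (0 : ℝ) ≤ K := K.cast_nonneg
  have hnK : (0 : ℝ) ≤ n * K := by positivity
  induction i with
  | zero =>
    refine Runs.mono (.pure rfl rfl) ?_
    norm_num [codeExpr, Expr.size]; nlinarith
  | succ i ih =>
    have ih := ih (by omega)
    have hiK : (i : ℝ) + 1 ≤ K := by exact_mod_cast hi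
    have hj : ∀ j : Fin 3, ((j : ℕ) : ℝ) ≤ 2 := fun j => by
      exact_mod_cast Nat.lt_succ_iff.1 j.2
    have hsize : ∀ j : Fin 3, ((blockLiteral i j).size : ℝ) ≤ K + 5 := fun j => by
      rw [blockLiteral_size]; push_cast; linarith [hj j]
    have hs₁ := hsize (c i)
    have hs₂ := hsize (c i + 1)
    have hs₃ := hsize (c i + 2)
    unfold codeState
    by_cases hlen : i < ls.length
    · rw [List.getElem?_eq_getElem hlen]
      refine Runs.mono (Runs.call rfl (.cons
        (.pure (blockLiteral_isPure _ _) (blockLiteral_value_some hlen _)) (.cons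
        (.pure (blockLiteral_isPure _ _) (blockLiteral_value_some hlen _)) (.cons
        (.pure (blockLiteral_isPure _ _) (blockLiteral_value_some hlen _)) ih)))
        (open_runs _ _ _ _)) ?_
      push_cast; nlinarith
    · rw [List.getElem?_eq_none (by omega)]
      refine Runs.mono (Runs.call rfl (.cons
        (.pure (blockLiteral_isPure _ _) (blockLiteral_value_none (by omega) _)) (.cons
        (.pure (blockLiteral_isPure _ _) (blockLiteral_value_none (by omega) _)) (.cons
        (.pure (blockLiteral_isPure _ _) (blockLiteral_value_none (by omega) _)) ih)))
        (open_nil_runs _)) ?_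
      push_cast; nlinarith

/-! ### The recursion on the groups of clauses -/

/-- The additional budget for a last, incomplete group of clauses. -/
def padding (K : ℕ) (ls : List (Fin 3 → Literal n)) : ℕ := if ls = [] then 0 else K

/-- What `expand` does with the list `ls`. -/
def ExpandSpec (K : ℕ) (table : List ((ℕ → Fin 3) × ℕ)) (α : Assignment n)
    (L : List (List (Literal n))) (r : ℕ) (C : ℝ) (ls : List (Fin 3 → Literal n)) : Prop :=
  ∀ (σ : State n) (W : ℕ), Valid α L (ls.map List.ofFn) σ → ∃ ans,
    Runs (program K table) [.cons (encTriples ls) (.cons (encInstance α L r)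
      (.cons σ.enc (Tree.ofNat W)))] (expandBody K table) (Tree.ofBool ans) (C * rate ^ W) ∧
    Answers α L r (fun β => Compatible σ (diff α β) ∧ weight σ (diff α β) + padding K ls ≤ W) ans

/-- A bound for the overhead of an entry of the table. -/
noncomputable def entryCost (K d : ℕ) : ℝ := 500 * (K + 1) ^ 2 + 2 * d

/-- The clause is false under `α` and true under `β`. This makes the targets nonempty, as the
covering table requires. -/
theorem Solution.exists_diff {β : Assignment n} (hβ : Solution α L r β)
    (h : Valid α L (ls.map List.ofFn) σ) : ∀ l ∈ ls, ∃ j, diff α β (l j).1 = true := by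
  intro l hl
  obtain ⟨h₁, h₂, -⟩ := h.mem _ (List.mem_map_of_mem hl)
  obtain ⟨t, ht, htβ⟩ := hβ.1 _ h₁
  obtain ⟨j, rfl⟩ := (List.mem_ofFn' _ _).1 ht
  exact ⟨j, diff_of_neg (fun e => h₂ ⟨_, ht, e⟩) htβ⟩

theorem entry_runs {C : ℝ} (hC : 0 ≤ C) (hL : DisjointTriples α L)
    (h : Valid α L (ls.map List.ofFn) σ) (hne : ls ≠ [])
    (ih : ExpandSpec K table α L r C (ls.drop K)) (c : ℕ → Fin 3) (d W : ℕ) :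
    ∃ ans, Runs ℙ [.cons (encTriples ls) (.cons (encInstance α L r)
        (.cons σ.enc (Tree.ofNat W)))] (entryExpr K c d) (Tree.ofBool ans)
        (C * rate ^ W * (rate ^ d)⁻¹ + (n + 1) * entryCost K d) ∧
      Answers α L r (fun β => (Compatible σ (diff α β) ∧ weight σ (diff α β) + padding K ls ≤ W) ∧
        d + 3 * K ≤ ∑ k ∈ Finset.range K, gain (c k) (target ls (diff α β) k)) ans := by
  have hn : (0 : ℝ) ≤ n := n.cast_nonneg
  have hK : (0 : ℝ) ≤ K := K.cast_nonneg
  have hd0 : (0 : ℝ) ≤ d := d.cast_nonneg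
  have hrate : (0 : ℝ) < rate := by norm_num
  have spec : ∀ β, Solution α L r β → Compatible σ (diff α β) →
      weight σ (diff α β) + padding K ls ≤ W →
      d + 3 * K ≤ ∑ k ∈ Finset.range K, gain (c k) (target ls (diff α β) k) →
      Compatible (codeState σ ls c K) (diff α β) ∧
        weight (codeState σ ls c K) (diff α β) + padding K (ls.drop K) + d ≤ W := by
    intro β hβ h₁ h₂ h₃
    obtain ⟨k₁, k₂⟩ := codeState_spec hL h h₁ (hβ.exists_diff h) c K
    refine ⟨k₁, ?_⟩
    -- If clauses remain, this group was complete and the padding is kept; otherwise the padding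
    -- pays for the at most `K` missing positions.
    unfold padding at h₂ ⊢
    rw [if_neg hne] at h₂
    split_ifs with he
    · omega
    · rw [List.drop_eq_nil_iff] at he
      omega
  obtain ⟨ans, hr, hans⟩ := pay_runs (P := ℙ)
    (env := [.cons (encTriples ls) (.cons (encInstance α L r) (.cons σ.enc (Tree.ofNat W)))])
    (w := .tl (.tl (.tl .arg))) (W := W) (d := d)
    (e := .call fExpand (.cons (Expr.drop (.hd .arg) K) (.cons (.hd (.tl .arg))
      (.cons (codeExpr c K) (Expr.drop (.tl (.tl (.tl .arg))) d)))))
    (T := C * rate ^ W * (rate ^ d)⁻¹ + 400 * (n + 1) * (K + 1) * (K + 1) + K + d + 20)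
    (Q := Answers α L r (fun β => (Compatible σ (diff α β) ∧
        weight σ (diff α β) + padding K ls ≤ W) ∧
        d + 3 * K ≤ ∑ k ∈ Finset.range K, gain (c k) (target ls (diff α β) k)))
    rfl rfl (by positivity)
    (fun hdW => by
      obtain ⟨ans, hr, hans⟩ := ih _ (W - d) (codeState_valid hL h c K)
      refine ⟨ans, ?_, hans.mono fun β hβ hp => ?_⟩
      · refine Runs.mono (Runs.call rfl (.cons
          (.pure (Expr.drop_isPure rfl K) (Expr.drop_value_ofList
            (enc := fun l => encClause (List.ofFn l)) (xs := ls) rfl K))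
          (.cons (.pure rfl rfl) (.cons (codeExpr_runs σ ls _ _ c K le_rfl)
            (.pure (Expr.drop_isPure rfl d) (Expr.drop_value_ofNat (W := W) rfl d))))) hr) ?_
        rw [rate_pow_sub hdW, Expr.drop_size, Expr.drop_size]
        norm_num [Expr.size]; linarith
      · obtain ⟨k₁, k₂⟩ := spec β hβ hp.1.1 hp.1.2 hp.2
        exact ⟨k₁, by omega⟩)
    (fun hlt => Answers.false fun β hβ hp => by
      obtain ⟨-, k₂⟩ := spec β hβ hp.1.1 hp.1.2 hp.2
      omega)
  refine ⟨ans, hr.mono ?_, hans⟩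
  unfold entryCost
  norm_num [Expr.size]; nlinarith [mul_nonneg hn hK, mul_nonneg hn hd0, sq_nonneg (K : ℝ),
    mul_nonneg hn (sq_nonneg (K : ℝ))]

theorem table_runs {C : ℝ} (hC : 0 ≤ C) (hL : DisjointTriples α L)
    (h : Valid α L (ls.map List.ofFn) σ) (hne : ls ≠ [])
    (ih : ExpandSpec K table α L r C (ls.drop K)) (W : ℕ) (tab : List ((ℕ → Fin 3) × ℕ)) :
    ∃ ans, Runs ℙ [.cons (encTriples ls) (.cons (encInstance α L r)
        (.cons σ.enc (Tree.ofNat W)))] (tableExpr K tab) (Tree.ofBool ans)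
        (C * rate ^ W * (tab.map fun x => (rate ^ x.2)⁻¹).sum +
          (n + 1) * (tab.map fun x => entryCost K x.2 + 4).sum + 1) ∧
      Answers α L r (fun β => (Compatible σ (diff α β) ∧ weight σ (diff α β) + padding K ls ≤ W) ∧
        ∃ x ∈ tab, x.2 + 3 * K ≤ ∑ k ∈ Finset.range K, gain (x.1 k) (target ls (diff α β) k))
        ans := by
  have hn : (0 : ℝ) ≤ n := n.cast_nonneg
  have hrate : (0 : ℝ) < rate := by norm_num
  induction tab with
  | nil =>
    refine ⟨false, Runs.mono (.pure rfl rfl) ?_, Answers.false fun β _ hβ => by simp at hβ⟩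
    norm_num [tableExpr, Expr.size]
  | cons x tab iht =>
    obtain ⟨a₁, r₁, k₁⟩ := entry_runs (table := table) hC hL h hne ih x.1 x.2 W
    obtain ⟨a₂, r₂, k₂⟩ := iht
    have s₁ : 0 ≤ (tab.map fun x => (rate ^ x.2)⁻¹).sum :=
      List.sum_nonneg (by simp only [List.mem_map]; rintro _ ⟨y, _, rfl⟩; positivity)
    have s₂ : 0 ≤ (tab.map fun x => entryCost K x.2 + 4).sum :=
      List.sum_nonneg (by
        simp only [List.mem_map]; rintro _ ⟨y, _, rfl⟩; unfold entryCost; positivity)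
    refine ⟨a₁ || a₂, Runs.mono (Runs.or r₁ r₂ (by positivity)) ?_,
      (k₁.or k₂).mono fun β _ hβ => ?_⟩
    · simp only [List.map_cons, List.sum_cons]
      linarith
    · obtain ⟨hR, y, hy, hg⟩ := hβ
      rcases List.mem_cons.1 hy with rfl | hy
      · exact .inl ⟨hR, hg⟩
      · exact .inr ⟨hR, y, hy, hg⟩

/-- The constant in the running time of `expand`. -/
noncomputable def tableCost (K : ℕ) (table : List ((ℕ → Fin 3) × ℕ)) : ℝ :=
  10 ^ 7 + 2 * (table.map fun x => entryCost K x.2 + 4).sum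

theorem tableCost_ge (K : ℕ) (table : List ((ℕ → Fin 3) × ℕ)) :
    0 ≤ (table.map fun x => entryCost K x.2 + 4).sum :=
  List.sum_nonneg (by
    simp only [List.mem_map]; rintro _ ⟨y, _, rfl⟩; unfold entryCost; positivity)

/-- By the Kraft inequality the recursive calls use at most half of the allowance `C * rate ^ W`,
whatever the number of groups; the other half pays for handling the table. Hence the constant does
not grow along the recursion. -/
theorem expand_runs (hK : 0 < K) (hkraft : (table.map fun x => (rate ^ x.2)⁻¹).sum ≤ 1 / 2)
    (hcover : ∀ S : ℕ → Fin 3 → Bool, (∀ i, ∃ j, S i j = true) →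
      ∃ x ∈ table, x.2 + 3 * K ≤ ∑ k ∈ Finset.range K, gain (x.1 k) (S k))
    (hlen : ∀ c ∈ L, c.length ≤ 3) (hL : DisjointTriples α L) (ls : List (Fin 3 → Literal n)) :
    ExpandSpec K table α L r (tableCost K table * ((n + 1) * (L.length + 1))) ls := by
  induction hm : ls.length using Nat.strong_induction_on generalizing ls with
  | _ m ih =>
    intro σ W hv
    have hn : (0 : ℝ) ≤ n := n.cast_nonneg
    have hm0 : (0 : ℝ) ≤ L.length := Nat.cast_nonneg _
    have hs := tableCost_ge K table
    have h1 : (1 : ℝ) ≤ rate ^ W := one_le_pow₀ (by norm_num)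
    have hnm : (n + 1 : ℝ) ≤ (n + 1) * (L.length + 1) := le_mul_of_one_le_right (by linarith)
      (by linarith)
    have hC : 0 ≤ tableCost K table * (((n : ℝ) + 1) * (L.length + 1)) := by
      unfold tableCost; positivity
    by_cases hne : ls = []
    · subst hne
      obtain ⟨ans, hr, hans⟩ := scan_runs (K := K) (table := table) (r := r) hlen W σ hv
      refine ⟨ans, Runs.mono (Runs.condNil (.pure rfl rfl)
        (Runs.call rfl (.pure rfl rfl) hr)) ?_, hans.mono fun β _ hβ => ?_⟩
      · have : searchCost n L.length + 50 ≤
            tableCost K table * (((n : ℝ) + 1) * (L.length + 1)) := by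
          unfold searchCost tableCost
          nlinarith [mul_nonneg hs (by positivity : (0 : ℝ) ≤ (n + 1) * (L.length + 1))]
        calc _ ≤ (searchCost n L.length + 50) * rate ^ W := by
              norm_num [Expr.size] at h1 ⊢; linarith
          _ ≤ _ := by gcongr
      · exact ⟨hβ.1, by simpa [padding] using hβ.2⟩
    · have hpos : 0 < ls.length := List.length_pos_iff.2 hne
      obtain ⟨ans, hr, hans⟩ := table_runs (table := table) hC hL hv hne
        (ih (ls.drop K).length (by rw [List.length_drop]; omega) (ls.drop K) rfl) W table
      obtain ⟨l, ls', rfl⟩ := List.exists_cons_of_ne_nil hne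
      refine ⟨ans, Runs.mono (Runs.condCons (.pure rfl rfl) hr) ?_,
        hans.mono fun β hβ hR => ⟨hR, hcover _ fun i => ?_⟩⟩
      · set C := tableCost K table * (((n : ℝ) + 1) * (L.length + 1)) with hCdef
        have h2 : C * rate ^ W * (table.map fun x => (rate ^ x.2)⁻¹).sum ≤ C * rate ^ W * (1 / 2) :=
          mul_le_mul_of_nonneg_left hkraft (by positivity)
        have h3 : (n + 1) * (table.map fun x => entryCost K x.2 + 4).sum + 10 ≤ C * (1 / 2) := by
          rw [hCdef]
          unfold tableCost
          nlinarith [mul_le_mul_of_nonneg_right hnm hs]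
        have h4 : C * (1 / 2) ≤ C * rate ^ W * (1 / 2) := by nlinarith
        norm_num [Expr.size] at h2 h3 h4 ⊢; linarith
      · unfold target
        cases h : (l :: ls')[i]? with
        | none => exact ⟨0, rfl⟩
        | some t => exact hβ.exists_diff hv t (List.mem_of_getElem? h)

end Expand

/-! ### The theorem -/

section Main

variable {n : ℕ}

theorem init_current (α : Assignment n) : (State.init n).current α = α := by
  funext i; simp [State.current, State.init, Status.flipped]

theorem init_valid {α : Assignment n} {L : List (List (Literal n))} (hL : L.Nodup) :
    Valid α L (L.filter fun c => !decide (ListSat α c)) (State.init n) where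
  core := by simp [State.init]
  side := by simp [State.init]
  flipped c hc hn := .inr (List.mem_filter.2 ⟨hc, by simpa [IsNeg] using hn⟩)
  nodup := hL.filter _
  mem b hb := by
    obtain ⟨h₁, h₂⟩ := List.mem_filter.1 hb
    exact ⟨h₁, by simpa [IsNeg] using h₂, fun _ _ => rfl⟩

theorem init_compatible (X : Fin n → Bool) : Compatible (State.init n) X := by
  intro i; simp [State.init]

theorem init_weight (X : Fin n → Bool) :
    weight (State.init n) X = 2 * (Finset.univ.filter fun i => X i = true).card := by
  simp only [weight, localWeight, State.init]
  rw [Finset.sum_ite, Finset.sum_const_zero, Finset.sum_const, smul_eq_mul]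
  ring

/-- The number of clauses with at most three literals is polynomial. -/
theorem length_le_of_length_le_three {L : List (List (Literal n))} (hL : L.Nodup)
    (h : ∀ c ∈ L, c.length ≤ 3) : L.length ≤ (2 * n + 1) ^ 3 := by
  classical
  rw [← List.toFinset_card_of_nodup hL]
  have hcard : Fintype.card (Fin 3 → Option (Literal n)) = (2 * n + 1) ^ 3 := by
    simp [mul_comm]
  rw [← hcard, ← Finset.card_univ]
  -- A list of length at most three is determined by its first three optional entries.
  refine Finset.card_le_card_of_injOn (fun u (i : Fin 3) => u[(i : ℕ)]?)
    (fun _ _ => Finset.mem_coe.2 (Finset.mem_univ _)) ?_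
  intro c hc d hd hcd
  have hc := h c (by simpa using hc)
  have hd := h d (by simpa using hd)
  apply List.ext_getElem?
  intro i
  by_cases hi : i < 3
  · exact congrFun hcd ⟨i, hi⟩
  · rw [List.getElem?_eq_none (by omega), List.getElem?_eq_none (by omega)]

theorem main_runs {K : ℕ} {table : List ((ℕ → Fin 3) × ℕ)} (hK : 0 < K)
    (hkraft : (table.map fun x => (rate ^ x.2)⁻¹).sum ≤ 1 / 2)
    (hcover : ∀ S : ℕ → Fin 3 → Bool, (∀ i, ∃ j, S i j = true) →
      ∃ x ∈ table, x.2 + 3 * K ≤ ∑ k ∈ Finset.range K, gain (x.1 k) (S k))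
    {α : Assignment n} {L : List (List (Literal n))} (hlen : ∀ c ∈ L, c.length ≤ 3)
    (hL : DisjointTriples α L) (hnodup : L.Nodup) (r : ℕ) :
    ∃ ans, Runs (program K table) [encInstance α L r] mainExpr (Tree.ofBool ans)
        ((tableCost K table * rate ^ K + 2000 + 10 * K) * ((n + 1) * (L.length + 1)) *
          rate ^ (2 * r)) ∧
      (ans = true ↔ ∃ β, Solution α L r β) := by
  have hn : (0 : ℝ) ≤ n := n.cast_nonneg
  have hm : (0 : ℝ) ≤ L.length := Nat.cast_nonneg _
  have hv := init_valid (α := α) hnodup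
  set bs := L.filter fun c => !decide (ListSat α c) with hbs
  obtain ⟨ls, hls⟩ : ∃ ls : List (Fin 3 → Literal n), ls.map List.ofFn = bs := by
    have : ∀ b ∈ bs, ∃ l : Fin 3 → Literal n, List.ofFn l = b := fun b hb => by
      obtain ⟨h₁, h₂, -⟩ := hv.mem b hb
      obtain ⟨l, hl, -⟩ := hL.triple b h₁ h₂
      exact ⟨l, hl.symm⟩
    choose f hf using this
    refine ⟨bs.attach.map fun b => f b.1 b.2, ?_⟩
    rw [List.map_map]
    exact (List.map_congr_left (g := Subtype.val) fun b _ => hf b.1 b.2).trans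
      (List.attach_map_subtype_val bs)
  have henc : encFormula bs = encTriples ls := by
    rw [← hls]
    clear hls
    induction ls with
    | nil => rfl
    | cons l ls ih => exact congrArg (Tree.cons _) ih
  rw [← hls] at hv
  have hneg := negs_runs (K := K) (table := table) α (State.init n) L hlen
  rw [init_current, ← hbs, henc] at hneg
  obtain ⟨ans, hr, hans⟩ := expand_runs (r := r) hK hkraft hcover hlen hL ls _ (2 * r + K) hv
  refine ⟨ans, Runs.mono (Runs.bind (Runs.call rfl (.pure rfl rfl) (init_runs α))
    (Runs.call rfl (.cons (Runs.call rfl (.pure rfl rfl) hneg) (.cons (.pure rfl rfl)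
      (.cons (.pure rfl rfl) (Runs.call rfl (.pure rfl rfl) (double_runs r))))) hr)) ?_,
    hans.1, fun ⟨β, hβ⟩ => hans.2 β hβ ⟨init_compatible _, ?_⟩⟩
  -- This absorbs the time for doubling `r` in unary, which is not bounded in terms of `n`.
  · have h1 : (1 : ℝ) + r ≤ rate ^ (2 * r) := by
      have := one_add_mul_le_pow (a := (1 : ℝ)) (by norm_num) r
      calc (1 : ℝ) + r ≤ (1 + 1) ^ r := by linarith
        _ ≤ (rate ^ 2) ^ r := by gcongr; norm_num
        _ = _ := by rw [pow_mul]
    set E := rate ^ (2 * r) with hE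
    set N := ((n : ℝ) + 1) * (L.length + 1) with hN
    have hN1 : (n : ℝ) + 1 ≤ N := le_mul_of_one_le_right (by linarith) (by linarith)
    have hr0 : (0 : ℝ) ≤ r := r.cast_nonneg
    have hE1 : 1 ≤ E := by linarith
    have hNE : N ≤ N * E := le_mul_of_one_le_right (by linarith) hE1
    have hEN : E ≤ N * E := le_mul_of_one_le_left (by linarith) (by linarith)
    have hK0 : (0 : ℝ) ≤ K := K.cast_nonneg
    have hKE : (K : ℝ) ≤ K * (N * E) := le_mul_of_one_le_right hK0 (by linarith)
    rw [pow_add, ← hE]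
    norm_num [Expr.size] at *
    nlinarith
  · rw [init_weight, card_diff]
    have := hβ.2
    unfold padding
    split_ifs <;> omega

/-! ### The value of the base and the translation of the hypotheses -/

theorem sqrt_bounds : 7.5 < √57 ∧ √57 < 7.55 :=
  ⟨Real.lt_sqrt_of_sq_lt (by norm_num), (Real.sqrt_lt' (by norm_num)).2 (by norm_num)⟩

theorem base_eq : base = (43 - √57) / 14 := by
  have h : √57 ^ 2 = (57 : ℝ) := Real.sq_sqrt (by norm_num)
  have hs := sqrt_bounds.1
  unfold base
  rw [div_eq_div_iff (by positivity) (by norm_num)]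
  linarith

theorem base_bounds : 2.532 < base ∧ base < 2.533 := by
  have h₁ : 7.54 < √57 := Real.lt_sqrt_of_sq_lt (by norm_num)
  have h₂ : √57 < 7.55 := (Real.sqrt_lt' (by norm_num)).2 (by norm_num)
  rw [base_eq]
  constructor <;> linarith

/-- In a clause that is false under `α` the variable of a literal determines its sign. So distinct
literals have distinct variables, and clauses without a common literal have no common variable. -/
theorem disjointTriples_of_lists {F : CNF n} {α : Assignment n}
    (h3 : ∀ C ∈ CNF.neg α F, C.card = 3)
    (hdisj : ∀ C ∈ CNF.neg α F, ∀ D ∈ CNF.neg α F, C ≠ D → Disjoint C D)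
    {L : List (List (Literal n))} (hL : Lists L F) : DisjointTriples α L := by
  obtain ⟨hnd, hmap, hF⟩ := hL
  have hneg : ∀ c ∈ L, IsNeg α c → c.toFinset ∈ CNF.neg α F := by
    intro c hc hn
    refine ⟨?_, fun l hl h => hn ⟨l, by simpa using hl, h⟩⟩
    rw [← hF]
    simpa using ⟨c, hc, rfl⟩
  have hsign : ∀ {c : List (Literal n)}, IsNeg α c → ∀ l ∈ c, l.2 = !α l.1 := by
    intro c hn l hl
    have : ¬ α l.1 = l.2 := fun e => hn ⟨l, hl, e⟩
    revert this
    cases α l.1 <;> cases l.2 <;> simp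
  constructor
  · intro u hc hn
    have hlen : u.length = 3 := by
      rw [← List.toFinset_card_of_nodup (hnd u hc)]
      exact h3 _ (hneg u hc hn)
    refine ⟨fun j => u[(j : ℕ)], List.ext_getElem (by simp [hlen])
      (by intro i _ _; rw [List.getElem_ofFn]), ?_⟩
    intro i j hij
    have hi := hsign hn u[(i : ℕ)] (List.getElem_mem _)
    have hj := hsign hn u[(j : ℕ)] (List.getElem_mem _)
    have : u[(i : ℕ)] = u[(j : ℕ)] := Prod.ext hij (by rw [hi, hj]; exact congrArg _ (congrArg _ hij))
    exact Fin.ext ((hnd u hc).getElem_inj_iff.1 this)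
  · rintro c hc d hd hcn hdn i ⟨l, hl, rfl⟩ ⟨t, ht, hti⟩
    have hlt : t = l := Prod.ext hti (by rw [hsign hcn l hl, hsign hdn t ht, hti])
    subst hlt
    refine List.inj_on_of_nodup_map hmap hc hd ?_
    by_contra hne
    exact Finset.disjoint_left.1 (hdisj _ (hneg c hc hcn) _ (hneg d hd hdn) hne)
      (by simpa using hl) (by simpa using ht)

theorem exists_solution_iff {F : CNF n} {α : Assignment n} {L : List (List (Literal n))} {r : ℕ}
    (hL : Lists L F) : (∃ β, Solution α L r β) ↔ SatInBall F α r := by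
  unfold SatInBall Solution CNF.Sat
  rw [← hL.2.2]
  simp [ListSat, Clause.Sat]

end Main

end BallSat

theorem lemma3 :
    (2.532 < BallSat.base ∧ BallSat.base < 2.533) ∧
    ∃ (P : BallSat.Program) (p : Polynomial ℕ),
      ∀ (n : ℕ) (F : BallSat.CNF n) (α : BallSat.Assignment n) (r : ℕ),
        (∀ C ∈ F, C.card ≤ 3) →
        (∀ C ∈ BallSat.CNF.neg α F, C.card = 3) →
        (∀ C ∈ BallSat.CNF.neg α F, ∀ D ∈ BallSat.CNF.neg α F, C ≠ D → Disjoint C D) →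
        ∀ L : List (List (BallSat.Literal n)), BallSat.Lists L F →
          ∃ (answer : Bool) (t : ℕ),
            P.Outputs (BallSat.Tree.ofInstance α L r) (BallSat.Tree.ofBool answer) t ∧
            (answer = true ↔ BallSat.SatInBall F α r) ∧
            (t : ℝ) ≤ ((p.eval n : ℕ) : ℝ) * BallSat.base ^ r := by
  open BallSat in
  refine ⟨base_bounds, ?_⟩
  obtain ⟨K, code, hK, hkraft, hcover⟩ := exists_code
  let table : List ((ℕ → Fin 3) × ℕ) :=
    -- The entries from `K` on are never used.
    code.map fun x => (fun k => if h : k < K then x.1 ⟨k, h⟩ else 0, x.2)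
  have hkraft' : (table.map fun x => (rate ^ x.2)⁻¹).sum ≤ 1 / 2 := by
    simpa only [table, List.map_map, Function.comp_def] using hkraft
  have hcover' : ∀ S : ℕ → Fin 3 → Bool, (∀ i, ∃ j, S i j = true) →
      ∃ x ∈ table, x.2 + 3 * K ≤ ∑ k ∈ Finset.range K, gain (x.1 k) (S k) := by
    intro S hS
    obtain ⟨x, hx, hg⟩ := hcover (fun i => S i) fun i => hS i
    refine ⟨_, List.mem_map_of_mem hx, hg.trans_eq ?_⟩
    rw [Finset.sum_range]
    simp [totalGain]
  set A : ℕ := ⌈tableCost K table * rate ^ K + 2000 + 10 * K⌉₊ with hA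
  refine ⟨program K table, Polynomial.C A * ((Polynomial.X + 1) *
    ((2 * Polynomial.X + 1) ^ 3 + 1)), ?_⟩
  intro n F α r hF h3 hdisj L hL
  have hnodup : L.Nodup := hL.2.1.of_map _
  have hlen : ∀ c ∈ L, c.length ≤ 3 := by
    intro c hc
    rw [← List.toFinset_card_of_nodup (hL.1 c hc)]
    apply hF
    rw [← hL.2.2]
    simpa using ⟨c, hc, rfl⟩
  obtain ⟨ans, ⟨t, ht, he⟩, hiff⟩ := main_runs hK hkraft' hcover' hlen
    (disjointTriples_of_lists h3 hdisj hL) hnodup r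
  refine ⟨ans, t, he, hiff.trans (exists_solution_iff hL), ht.trans ?_⟩
  have hcount : (L.length : ℝ) ≤ (2 * n + 1) ^ 3 := by
    exact_mod_cast length_le_of_length_le_three hnodup hlen
  -- The only comparison with `base`: `1.59 ^ 2 = 2.5281 < 2.532`.
  have hbase : rate ^ (2 * r) ≤ base ^ r := by
    rw [pow_mul]
    have := base_bounds.1
    gcongr
    norm_num at this ⊢
    linarith
  have hcost : 0 ≤ tableCost K table * rate ^ K + 2000 + 10 * K := by
    have := tableCost_ge K table
    unfold tableCost; positivity
  simp only [Polynomial.eval_mul, Polynomial.eval_add, Polynomial.eval_pow, Polynomial.eval_C,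
    Polynomial.eval_X, Polynomial.eval_one, Polynomial.eval_ofNat]
  push_cast
  gcongr
  exact Nat.le_ceil _
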